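/- **Setting.** Let $n_1\le n_2$, $m\ge 0$, $k\ge 1$ be integers. For $x\in\mathbb R^{n}$ let $\|x\|_0$ be the number of nonzero entries and let $x^k$ be the restriction of $x$ to its $k$ entries of largest absolute value (ties broken arbitrarily). For $X\in\mathbb R^{n_1\times n_2}$ with singular values $\sigma_1(X)\ge\dots\ge\sigma_{n_1}(X)$ let $\|X\|_\star=\sum_i\sigma_i(X)$, let $\|X\|_F$ be the Frobenius norm, and let $X^k$ be the sum of the first $k$ terms of a (any) singular value decomposition of $X$. The restricted isometry constant $\delta_k$ of $A\in\mathbb R^{m\times n}$ is the smallest $\delta\ge 0$ with $(1-\delta)\|x\|_2^2\le\|Ax\|_2^2\le(1+\delta)\|x\|_2^2$ for all $x$ with $\|x\|_0\le k$; the restricted orthogonality constant $\theta_{k,k'}$ is the smallest $\theta\ge0$ with $|\langle Ax,Ax'\rangle|\le\theta\|x\|_2\|x'\|_2$ for all $x,x'$ with disjoint supports, $\|x\|_0\le k$, $\|x'\|_0\le k'$. For a linear operator $\mathcal A:\mathbb R^{n_1\times n_2}\to\mathbb R^m$ they are defined in the same way, with matrices $X$ of rank at most $k$ instead of $k$-sparse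 vectors, $\|\cdot\|_F$ instead of $\|\cdot\|_2$, and, for $\theta_{k,k'}$, pairs $X,X'$ of rank at most $k$ and $k'$ with orthogonal column spaces and orthogonal row spaces. An *RIP inequality* is an inequality $f(\delta_{i_1},\dots,\delta_{i_p},\theta_{j_1,j_1'},\dots,\theta_{j_q,j_q'})\le c$ with $c\ge0$ and a function $f$ that is nondecreasing in its nonnegative arguments and satisfies $f(0,\dots,0)=0$. For a noise level $\varepsilon$ and measurements $y$, a vector $x^*$ is *as good as* $x_0$ if $\|Ax^*-y\|_2\le\varepsilon$ and $\|x^*\|_1\le\|x_0\|_1$; a matrix $X^*$ is *as good as* $X_0$ if $\|\mathcal A(X^*)-y\|_2\le\varepsilon$ and $\|X^*\|_\star\le\|X_0\|_\star$. **Lemma.** (a) Let $\mathcal F$ be a set of RIP inequalities, $\varepsilon, C_1,C_2,C_3\in\mathbb R$. (i) Suppose that for every $A\in\mathbb R^{m\times n_1}$ satisfying $\mathcal F$, all $x_0$, all $z$ with $\|z\|_2\le\varepsilon$, and all $x^*$ as good as $x_0$ with respect to $y=Ax_0+z$, $$\|x_0-x^*\|_2\le\frac{C_1}{\sqrt k}\|x_0-x_0^k\|_1+C_2\varepsilon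 .$$ Then for every $\mathcal A:\mathbb R^{n_1\times n_2}\to\mathbb R^m$ satisfying $\mathcal F$, all $X_0$, all $z$ with $\|z\|_2\le\varepsilon$, and all $X^*$ as good as $X_0$ with respect to $y=\mathcal A(X_0)+z$, $$\|X_0-X^*\|_F\le\frac{C_1}{\sqrt k}\|X_0-X_0^k\|_\star+C_2\varepsilon .$$ (ii) In the same way, at the same noise level $\varepsilon$, if $\mathcal F$ guarantees $\|x_0-x^*\|_1\le C_3\|x_0-x_0^k\|_1$ for vectors, then it guarantees $\|X_0-X^*\|_\star\le C_3\|X_0-X_0^k\|_\star$ for matrices. (Apart from degenerate cases such a bound is possible only in the noiseless case $\varepsilon=0$.) (b) There are absolute constants $C_1,C_2,C_3>0$ such that for all $m$, $n_1\le n_2$, $k\ge1$ and every $\mathcal A:\mathbb R^{n_1\times n_2}\to\mathbb R^m$ with $\delta_{2k}<0.472$, or with $k\ge2$ and $\delta_k<0.307$: for all $\varepsilon$, $X_0$, all $z$ with $\|z\|_2\le\varepsilon$ and all $X^*$ as good as $X_0$ with respect to $y=\mathcal A(X_0)+z$, $$\|X_0-X^*\|_F\le\frac{C_1}{\sqrt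 k}\|X_0-X_0^k\|_\star+C_2\varepsilon ,$$ and, if $\varepsilon=0$, also $\|X_0-X^*\|_\star\le C_3\|X_0-X_0^k\|_\star$. -/

import Mathlib

namespace LowRank

noncomputable section

/-- The vector space `ℝⁿ` with its Euclidean norm. -/
abbrev Vec (n : ℕ) : Type := EuclideanSpace ℝ (Fin n)

/-- A linear measurement operator `ℝ^{n₁ × n₂} → ℝᵐ`. -/
abbrev MeasOp (m n₁ n₂ : ℕ) : Type := Matrix (Fin n₁) (Fin n₂) ℝ →ₗ[ℝ] Vec m

/-! ### Vectors -/

/-- The number `‖x‖₀` of nonzero entries. -/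
def nnzCount {n : ℕ} (x : Vec n) : ℕ := (Finset.univ.filter fun i => x i ≠ 0).card

/-- The `ℓ₁` norm. -/
def l1Norm {n : ℕ} (x : Vec n) : ℝ := ∑ i, |x i|

/-- `y` is the restriction of `x` to its `k` entries of largest absolute value (to all entries if
`k ≥ n`). If there are ties, every way of breaking them is admitted. -/
def IsTopRestriction {n : ℕ} (x : Vec n) (k : ℕ) (y : Vec n) : Prop :=
  ∃ S : Finset (Fin n), S.card = min k n ∧ (∀ i ∈ S, ∀ j ∉ S, |x j| ≤ |x i|) ∧
    ∀ i, y i = if i ∈ S then x i else 0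

/-- `x'` is as good as `x₀` with respect to the measurements `y` and the noise level `ε`. -/
def VecAsGood {m n : ℕ} (A : Matrix (Fin m) (Fin n) ℝ) (ε : ℝ) (y : Vec m) (x₀ x' : Vec n) :
    Prop :=
  ‖A.toEuclideanLin x' - y‖ ≤ ε ∧ l1Norm x' ≤ l1Norm x₀

/-! ### Matrices -/

/-- The `i`-th largest singular value (indices start at `0`). -/
def sigma {n₁ n₂ : ℕ} (X : Matrix (Fin n₁) (Fin n₂) ℝ) (i : ℕ) : ℝ :=
  X.toEuclideanLin.singularValues i

/-- The nuclear norm; it is used for `n₁ ≤ n₂` only, where there are `n₁` singular values. -/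
def nuclearNorm {n₁ n₂ : ℕ} (X : Matrix (Fin n₁) (Fin n₂) ℝ) : ℝ :=
  ∑ i : Fin n₁, sigma X i

/-- The Frobenius norm. -/
def frobNorm {n₁ n₂ : ℕ} (X : Matrix (Fin n₁) (Fin n₂) ℝ) : ℝ :=
  Real.sqrt (∑ i, ∑ j, X i j ^ 2)

/-- `(U, V)` is a unitary pair. -/
def IsUnitaryPair {n₁ n₂ : ℕ} (U : Matrix (Fin n₁) (Fin n₁) ℝ) (V : Matrix (Fin n₂) (Fin n₁) ℝ) :
    Prop :=
  U.transpose * U = 1 ∧ U * U.transpose = 1 ∧ V.transpose * V = 1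

/-- `Y` is obtained by keeping the first `k` terms of a singular value decomposition of `X`.
All decompositions are admitted. -/
def IsSVDTruncation {n₁ n₂ : ℕ} (X : Matrix (Fin n₁) (Fin n₂) ℝ) (k : ℕ)
    (Y : Matrix (Fin n₁) (Fin n₂) ℝ) : Prop :=
  ∃ (U : Matrix (Fin n₁) (Fin n₁) ℝ) (V : Matrix (Fin n₂) (Fin n₁) ℝ), IsUnitaryPair U V ∧
    X = U * Matrix.diagonal (fun i : Fin n₁ => sigma X i) * V.transpose ∧
    Y = U * Matrix.diagonal (fun i : Fin n₁ => if (i : ℕ) < k then sigma X i else 0) *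
      V.transpose

/-- `X'` is as good as `X₀` with respect to the measurements `y` and the noise level `ε`. -/
def MatAsGood {m n₁ n₂ : ℕ} (𝒜 : MeasOp m n₁ n₂) (ε : ℝ) (y : Vec m)
    (X₀ X' : Matrix (Fin n₁) (Fin n₂) ℝ) : Prop :=
  ‖𝒜 X' - y‖ ≤ ε ∧ nuclearNorm X' ≤ nuclearNorm X₀

/-! ### Restricted isometry and restricted orthogonality constants

In each case the infimum is over a nonempty closed set of nonnegative reals, so it is the smallest
admissible constant. -/

/-- The restricted isometry constant `δ_k` of a matrix acting on vectors. -/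
def vecRIC {m n : ℕ} (A : Matrix (Fin m) (Fin n) ℝ) (k : ℕ) : ℝ :=
  sInf {δ : ℝ | 0 ≤ δ ∧ ∀ x : Vec n, nnzCount x ≤ k →
    (1 - δ) * ‖x‖ ^ 2 ≤ ‖A.toEuclideanLin x‖ ^ 2 ∧
    ‖A.toEuclideanLin x‖ ^ 2 ≤ (1 + δ) * ‖x‖ ^ 2}

/-- The restricted isometry constant `δ_k` of an operator acting on matrices. -/
def opRIC {m n₁ n₂ : ℕ} (𝒜 : MeasOp m n₁ n₂) (k : ℕ) : ℝ :=
  sInf {δ : ℝ | 0 ≤ δ ∧ ∀ X : Matrix (Fin n₁) (Fin n₂) ℝ, X.rank ≤ k →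
    (1 - δ) * frobNorm X ^ 2 ≤ ‖𝒜 X‖ ^ 2 ∧ ‖𝒜 X‖ ^ 2 ≤ (1 + δ) * frobNorm X ^ 2}

/-- The restricted orthogonality constant `θ_{k,k'}` of a matrix acting on vectors. -/
def vecROC {m n : ℕ} (A : Matrix (Fin m) (Fin n) ℝ) (k k' : ℕ) : ℝ :=
  sInf {θ : ℝ | 0 ≤ θ ∧ ∀ x x' : Vec n, nnzCount x ≤ k → nnzCount x' ≤ k' →
    (∀ i, x i = 0 ∨ x' i = 0) →
    |inner ℝ (A.toEuclideanLin x) (A.toEuclideanLin x')| ≤ θ * ‖x‖ * ‖x'‖}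

/-- The restricted orthogonality constant `θ_{k,k'}` of an operator acting on matrices: the two
matrices have orthogonal column spaces (`Xᵀ X' = 0`) and orthogonal row spaces (`X X'ᵀ = 0`). -/
def opROC {m n₁ n₂ : ℕ} (𝒜 : MeasOp m n₁ n₂) (k k' : ℕ) : ℝ :=
  sInf {θ : ℝ | 0 ≤ θ ∧ ∀ X X' : Matrix (Fin n₁) (Fin n₂) ℝ, X.rank ≤ k → X'.rank ≤ k' →
    X.transpose * X' = 0 → X * X'.transpose = 0 →
    |inner ℝ (𝒜 X) (𝒜 X')| ≤ θ * frobNorm X * frobNorm X'}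

/-- An RIP inequality `f (δ_{i₁}, …, δ_{i_p}, θ_{j₁,j₁'}, …, θ_{j_q,j_q'}) ≤ c`: here `c ≥ 0`, and
`f` is increasing (in the weak sense) in its nonnegative arguments and vanishes at the origin. -/
structure RIPInequality where
  p : ℕ
  q : ℕ
  ricIndex : Fin p → ℕ
  rocIndex : Fin q → ℕ × ℕ
  f : (Fin p → ℝ) → (Fin q → ℝ) → ℝ
  c : ℝ
  mono : ∀ δ δ' θ θ', 0 ≤ δ → δ ≤ δ' → 0 ≤ θ → θ ≤ θ' → f δ θ ≤ f δ' θ'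
  map_zero : f 0 0 = 0
  c_nonneg : 0 ≤ c

/-- The matrix `A` satisfies all the RIP inequalities in `F`. -/
def VecSatisfies {m n : ℕ} (F : Set RIPInequality) (A : Matrix (Fin m) (Fin n) ℝ) : Prop :=
  ∀ I ∈ F, I.f (fun s => vecRIC A (I.ricIndex s))
    (fun s => vecROC A (I.rocIndex s).1 (I.rocIndex s).2) ≤ I.c

/-- The operator `𝒜` satisfies all the RIP inequalities in `F`. -/
def OpSatisfies {m n₁ n₂ : ℕ} (F : Set RIPInequality) (𝒜 : MeasOp m n₁ n₂) : Prop :=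
  ∀ I ∈ F, I.f (fun s => opRIC 𝒜 (I.ricIndex s))
    (fun s => opROC 𝒜 (I.rocIndex s).1 (I.rocIndex s).2) ≤ I.c

/-! ### Robust recovery -/

/-- Robust recovery of vectors in the `ℓ₂` norm at noise level `ε`. -/
def VecL2Robust {m n : ℕ} (A : Matrix (Fin m) (Fin n) ℝ) (k : ℕ) (ε C₁ C₂ : ℝ) : Prop :=
  ∀ (x₀ x' xk : Vec n) (z : Vec m), ‖z‖ ≤ ε → VecAsGood A ε (A.toEuclideanLin x₀ + z) x₀ x' →
    IsTopRestriction x₀ k xk →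
    ‖x₀ - x'‖ ≤ C₁ / Real.sqrt k * l1Norm (x₀ - xk) + C₂ * ε

/-- Robust recovery of vectors in the `ℓ₁` norm at noise level `ε`. -/
def VecL1Robust {m n : ℕ} (A : Matrix (Fin m) (Fin n) ℝ) (k : ℕ) (ε C₃ : ℝ) : Prop :=
  ∀ (x₀ x' xk : Vec n) (z : Vec m), ‖z‖ ≤ ε → VecAsGood A ε (A.toEuclideanLin x₀ + z) x₀ x' →
    IsTopRestriction x₀ k xk →
    l1Norm (x₀ - x') ≤ C₃ * l1Norm (x₀ - xk)

/-- Robust recovery of matrices in the Frobenius norm at noise level `ε`. -/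
def MatFrobRobust {m n₁ n₂ : ℕ} (𝒜 : MeasOp m n₁ n₂) (k : ℕ) (ε C₁ C₂ : ℝ) : Prop :=
  ∀ (X₀ X' Xk : Matrix (Fin n₁) (Fin n₂) ℝ) (z : Vec m), ‖z‖ ≤ ε →
    MatAsGood 𝒜 ε (𝒜 X₀ + z) X₀ X' → IsSVDTruncation X₀ k Xk →
    frobNorm (X₀ - X') ≤ C₁ / Real.sqrt k * nuclearNorm (X₀ - Xk) + C₂ * ε

/-- Robust recovery of matrices in the nuclear norm at noise level `ε`. -/
def MatNuclearRobust {m n₁ n₂ : ℕ} (𝒜 : MeasOp m n₁ n₂) (k : ℕ) (ε C₃ : ℝ) : Prop :=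
  ∀ (X₀ X' Xk : Matrix (Fin n₁) (Fin n₂) ℝ) (z : Vec m), ‖z‖ ≤ ε →
    MatAsGood 𝒜 ε (𝒜 X₀ + z) X₀ X' → IsSVDTruncation X₀ k Xk →
    nuclearNorm (X₀ - X') ≤ C₃ * nuclearNorm (X₀ - Xk)

end

end LowRank

open LowRank

/-!
Writing the error as `X₀ - X' = U * diagonal d * Vᵀ` with orthonormal columns, the operator
`x ↦ 𝒜 (U * diagonal x * Vᵀ)` on vectors inherits every RIP inequality of `𝒜`: the map
`x ↦ U * diagonal x * Vᵀ` turns sparsity into rank, disjointness of supports into orthogonality of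
row and column spaces, and is an isometry. Let `x₀ = σ(X₀)` and `x' = σ(X₀) - d`. Mirsky's
inequality `∑ |σᵢ(X₀) - σᵢ(X₀ - X')| ≤ ‖X'‖⋆` shows that `x'` is as good as `x₀`, so the vector
result bounds `d`, which has the norms of `X₀ - X'`.

For vectors, let `a` be the restriction of the error `h` to its `k` largest entries. The remainder
`b = h - a` is flat: `‖b‖_∞ ≤ β / √k` and `‖b‖₁ ≤ √k β` for some `β` close to `‖a‖`. Weights in
`[0, 1]` with sum at most `k` are averages of indicators of sets of at most `k` elements, so
`θ_{k,k}` bounds `⟨A b, A a⟩` by `θ β ‖a‖`, as if `b` were `k`-sparse. As `A h` is small,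
`δ_k + θ_{k,k} < 1` is enough to bound `‖a‖`. Polarization gives `θ_{k,k} ≤ δ_{2k}`; splitting the
support into halves and averaging gives `θ_{k,k} ≤ √(9/2) δ_k` for `k ≥ 2`, and
`(1 + √(9/2)) * 0.307 < 1`.
-/

namespace LowRank

section Spectral

open Module Submodule InnerProductSpace
open scoped InnerProductSpace

variable {𝕜 E F : Type*} [RCLike 𝕜]
  [NormedAddCommGroup E] [InnerProductSpace 𝕜 E]
  [NormedAddCommGroup F] [InnerProductSpace 𝕜 F]

theorem inner_eq_zero_of_mem_span_image {ι : Type*} {v : ι → E} (hv : Orthonormal 𝕜 v)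
    {s : Set ι} {x : E} (hx : x ∈ span 𝕜 (v '' s)) {i : ι} (hi : i ∉ s) : ⟪v i, x⟫_𝕜 = 0 := by
  have h : span 𝕜 (v '' s) ≤ (𝕜 ∙ v i)ᗮ := by
    rw [span_le]
    rintro _ ⟨j, hj, rfl⟩
    exact mem_orthogonal_singleton_iff_inner_right.2 (hv.inner_eq_zero fun h => hi (h ▸ hj))
  exact mem_orthogonal_singleton_iff_inner_right.1 (h hx)

theorem finrank_span_image_of_orthonormal {ι : Type*} {v : ι → E} (hv : Orthonormal 𝕜 v)
    (s : Finset ι) : finrank 𝕜 (span 𝕜 (v '' s)) = s.card := by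
  classical
  rw [← Finset.coe_image, finrank_span_finset_eq_card, Finset.card_image_of_injective _
    hv.linearIndependent.injective]
  rw [Finset.coe_image]
  exact (hv.linearIndependent.linearIndepOn_id).mono (Set.image_subset_range _ _)

theorem isSymmetric_sum_smul_rankOne {ι : Type*} [Fintype ι] (c : ι → ℝ) (w : ι → E) :
    (∑ i, (c i : 𝕜) • (rankOne 𝕜 (w i) (w i)).toLinearMap).IsSymmetric :=
  Finset.sum_induction _ LinearMap.IsSymmetric (fun _ _ => .add) .zero fun i _ =>
    (isSymmetric_rankOne_self (w i)).smul (RCLike.conj_ofReal _)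

theorem re_inner_sum_smul_rankOne_apply_self {ι : Type*} [Fintype ι] (c : ι → ℝ)
    (w : ι → E) (x : E) :
    RCLike.re ⟪(∑ i, (c i : 𝕜) • (rankOne 𝕜 (w i) (w i)).toLinearMap) x, x⟫_𝕜 =
      ∑ i, c i * ‖⟪w i, x⟫_𝕜‖ ^ 2 := by
  simp only [LinearMap.sum_apply, sum_inner, map_sum]
  refine Finset.sum_congr rfl fun i _ => ?_
  rw [LinearMap.smul_apply, inner_smul_left, RCLike.conj_ofReal, RCLike.re_ofReal_mul,
    ContinuousLinearMap.coe_coe, inner_left_rankOne_apply, inner_mul_symm_re_eq_norm, norm_mul,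
    norm_inner_symm, sq]

variable [FiniteDimensional 𝕜 E] {n : ℕ}

theorem re_trace_sum_smul_rankOne {ι : Type*} [Fintype ι] (c : ι → ℝ) (w : ι → E) :
    RCLike.re (LinearMap.trace 𝕜 E (∑ i, (c i : 𝕜) • (rankOne 𝕜 (w i) (w i)).toLinearMap)) =
      ∑ i, c i * ‖w i‖ ^ 2 := by
  simp only [map_sum, map_smul, trace_rankOne, smul_eq_mul, RCLike.re_ofReal_mul,
    inner_self_eq_norm_sq]

theorem re_inner_apply_self_eq_sum_eigenvalues {T : E →ₗ[𝕜] E} (hT : T.IsSymmetric)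
    (hn : finrank 𝕜 E = n) (x : E) :
    RCLike.re ⟪T x, x⟫_𝕜 =
      ∑ i, hT.eigenvalues hn i * ‖⟪hT.eigenvectorBasis hn i, x⟫_𝕜‖ ^ 2 := by
  rw [← (hT.eigenvectorBasis hn).sum_inner_mul_inner (T x) x, map_sum]
  refine Finset.sum_congr rfl fun i _ => ?_
  rw [hT, hT.apply_eigenvectorBasis, inner_smul_right, mul_assoc, RCLike.re_ofReal_mul,
    inner_mul_symm_re_eq_norm, norm_mul, norm_inner_symm, sq]

theorem exists_submodule_eigenvalues_mul_le {T : E →ₗ[𝕜] E} (hT : T.IsSymmetric)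
    (hn : finrank 𝕜 E = n) (i : Fin n) :
    ∃ S : Submodule 𝕜 E, finrank 𝕜 S = i + 1 ∧
      ∀ x ∈ S, hT.eigenvalues hn i * ‖x‖ ^ 2 ≤ RCLike.re ⟪T x, x⟫_𝕜 := by
  set e := hT.eigenvectorBasis hn
  refine ⟨span 𝕜 (e '' Finset.Iic i), by
    rw [finrank_span_image_of_orthonormal e.orthonormal, Fin.card_Iic], fun x hx => ?_⟩
  rw [re_inner_apply_self_eq_sum_eigenvalues hT hn, ← e.sum_sq_norm_inner_right x, Finset.mul_sum]
  refine Finset.sum_le_sum fun j _ => ?_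
  by_cases hj : j ≤ i
  · gcongr
    exact hT.eigenvalues_antitone hn hj
  · simp [e, inner_eq_zero_of_mem_span_image e.orthonormal hx (i := j) (by simpa using hj)]

theorem exists_submodule_le_eigenvalues_mul {T : E →ₗ[𝕜] E} (hT : T.IsSymmetric)
    (hn : finrank 𝕜 E = n) (i : Fin n) :
    ∃ S : Submodule 𝕜 E, finrank 𝕜 S + i = n ∧
      ∀ x ∈ S, RCLike.re ⟪T x, x⟫_𝕜 ≤ hT.eigenvalues hn i * ‖x‖ ^ 2 := by
  set e := hT.eigenvectorBasis hn
  refine ⟨span 𝕜 (e '' Finset.Ici i), by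
    rw [finrank_span_image_of_orthonormal e.orthonormal, Fin.card_Ici]; omega, fun x hx => ?_⟩
  rw [re_inner_apply_self_eq_sum_eigenvalues hT hn, ← e.sum_sq_norm_inner_right x, Finset.mul_sum]
  refine Finset.sum_le_sum fun j _ => ?_
  by_cases hj : i ≤ j
  · gcongr
    exact hT.eigenvalues_antitone hn hj
  · simp [e, inner_eq_zero_of_mem_span_image e.orthonormal hx (i := j) (by simpa using hj)]

theorem le_eigenvalues_of_injective {T : E →ₗ[𝕜] E} (hT : T.IsSymmetric) (hn : finrank 𝕜 E = n)
    {i : Fin n} {c : ℝ} {G : Type*} [AddCommGroup G] [Module 𝕜 G] {J : G →ₗ[𝕜] E}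
    (hJ : Function.Injective J) (hi : i < finrank 𝕜 G)
    (h : ∀ x, c * ‖J x‖ ^ 2 ≤ RCLike.re ⟪T (J x), J x⟫_𝕜) : c ≤ hT.eigenvalues hn i := by
  obtain ⟨S, hS, hle⟩ := exists_submodule_le_eigenvalues_mul hT hn i
  have hmeet : ¬ Disjoint (LinearMap.range J) S := fun hdisj => by
    have := finrank_add_finrank_le_of_disjoint hdisj
    rw [LinearMap.finrank_range_of_inj hJ] at this
    omega
  obtain ⟨_, ⟨⟨x, rfl⟩, hxS⟩, hx0⟩ := exists_mem_ne_zero_of_ne_bot (disjoint_iff.not.1 hmeet)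
  exact le_of_mul_le_mul_right ((h x).trans (hle _ hxS)) (pow_pos (norm_pos_iff.2 hx0) 2)

variable [FiniteDimensional 𝕜 F]

theorem re_inner_adjoint_comp_self (f : E →ₗ[𝕜] F) (x : E) :
    RCLike.re ⟪(f.adjoint ∘ₗ f) x, x⟫_𝕜 = ‖f x‖ ^ 2 := by
  rw [LinearMap.comp_apply, LinearMap.adjoint_inner_left, inner_self_eq_norm_sq]

theorem exists_submodule_singularValues_mul_le (f : E →ₗ[𝕜] F) {i : ℕ} (hi : i < finrank 𝕜 E) :
    ∃ S : Submodule 𝕜 E, finrank 𝕜 S = i + 1 ∧ ∀ x ∈ S, f.singularValues i * ‖x‖ ≤ ‖f x‖ := by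
  obtain ⟨S, hS, hle⟩ :=
    exists_submodule_eigenvalues_mul_le f.isSymmetric_adjoint_comp_self rfl ⟨i, hi⟩
  refine ⟨S, hS, fun x hx => le_of_sq_le_sq ?_ (norm_nonneg _)⟩
  rw [mul_pow, ← re_inner_adjoint_comp_self, f.sq_singularValues_of_lt rfl hi]
  exact hle x hx

theorem exists_submodule_le_singularValues_mul (f : E →ₗ[𝕜] F) (i : ℕ) :
    ∃ S : Submodule 𝕜 E, finrank 𝕜 E ≤ finrank 𝕜 S + i ∧
      ∀ x ∈ S, ‖f x‖ ≤ f.singularValues i * ‖x‖ := by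
  obtain hi | hi := le_or_gt (finrank 𝕜 E) i
  · exact ⟨⊥, by omega, by simp⟩
  obtain ⟨S, hS, hle⟩ :=
    exists_submodule_le_eigenvalues_mul f.isSymmetric_adjoint_comp_self rfl ⟨i, hi⟩
  refine ⟨S, hS.ge, fun x hx => le_of_sq_le_sq ?_
    (mul_nonneg (f.singularValues_nonneg i) (norm_nonneg _))⟩
  rw [mul_pow, ← re_inner_adjoint_comp_self, f.sq_singularValues_of_lt rfl hi]
  exact hle x hx

end Spectral

section Dilation

open Module Submodule InnerProductSpace WithLp
open scoped InnerProductSpace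

variable {𝕜 E F : Type*} [RCLike 𝕜]
  [NormedAddCommGroup E] [InnerProductSpace 𝕜 E] [FiniteDimensional 𝕜 E]
  [NormedAddCommGroup F] [InnerProductSpace 𝕜 F] [FiniteDimensional 𝕜 F]

/-- The Hermitian dilation `(x, y) ↦ (f* y, f x)` of `f`, which reduces statements about the
singular values of `f` to statements about the eigenvalues of a symmetric operator. -/
noncomputable def hermitianDilation (f : E →ₗ[𝕜] F) : WithLp 2 (E × F) →ₗ[𝕜] WithLp 2 (E × F) :=
  (WithLp.linearEquiv 2 𝕜 (E × F)).symm ∘ₗ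
    (f.adjoint ∘ₗ LinearMap.snd 𝕜 E F).prod (f ∘ₗ LinearMap.fst 𝕜 E F) ∘ₗ
      (WithLp.linearEquiv 2 𝕜 (E × F))

theorem hermitianDilation_apply (f : E →ₗ[𝕜] F) (p : WithLp 2 (E × F)) :
    hermitianDilation f p = toLp 2 (f.adjoint p.snd, f p.fst) := rfl

theorem isSymmetric_hermitianDilation (f : E →ₗ[𝕜] F) : (hermitianDilation f).IsSymmetric := by
  intro p q
  simp only [hermitianDilation_apply, prod_inner_apply, LinearMap.adjoint_inner_left,
    LinearMap.adjoint_inner_right]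
  exact add_comm _ _

theorem re_inner_hermitianDilation_apply_self (f : E →ₗ[𝕜] F) (x : E) (y : F) :
    RCLike.re ⟪hermitianDilation f (toLp 2 (x, y)), toLp 2 (x, y)⟫_𝕜 =
      2 * RCLike.re ⟪f x, y⟫_𝕜 := by
  have h : ⟪hermitianDilation f (toLp 2 (x, y)), toLp 2 (x, y)⟫_𝕜 =
      ⟪f.adjoint y, x⟫_𝕜 + ⟪f x, y⟫_𝕜 := prod_inner_apply _ _
  rw [h, map_add, LinearMap.adjoint_inner_left, inner_re_symm, two_mul]

theorem trace_hermitianDilation (f : E →ₗ[𝕜] F) :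
    (hermitianDilation f).trace 𝕜 (WithLp 2 (E × F)) = 0 := by
  rw [LinearMap.trace_eq_sum_inner _
    ((stdOrthonormalBasis 𝕜 E).prod (stdOrthonormalBasis 𝕜 F)), Fintype.sum_sum_type]
  simp [hermitianDilation_apply]

theorem finrank_withLp_prod :
    finrank 𝕜 (WithLp 2 (E × F)) = finrank 𝕜 E + finrank 𝕜 F := by
  rw [(WithLp.linearEquiv 2 𝕜 (E × F)).finrank_eq, finrank_prod]

theorem hermitianDilation_le_iff {f : E →ₗ[𝕜] F} {C : WithLp 2 (E × F) →ₗ[𝕜] WithLp 2 (E × F)}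
    (hC : C.IsSymmetric) :
    hermitianDilation f ≤ C ↔ ∀ x y, 2 * RCLike.re ⟪f x, y⟫_𝕜 ≤
      RCLike.re ⟪C (toLp 2 (x, y)), toLp 2 (x, y)⟫_𝕜 := by
  have hform (x y) : 2 * RCLike.re ⟪f x, y⟫_𝕜 ≤ RCLike.re ⟪C (toLp 2 (x, y)), toLp 2 (x, y)⟫_𝕜 ↔
      0 ≤ RCLike.re ⟪(C - hermitianDilation f) (toLp 2 (x, y)), toLp 2 (x, y)⟫_𝕜 := by
    rw [LinearMap.sub_apply, inner_sub_left, map_sub, sub_nonneg,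
      re_inner_hermitianDilation_apply_self]
  simp only [LinearMap.le_def, hform]
  exact ⟨fun h x y => h.re_inner_nonneg_left _,
    fun h => ⟨hC.sub (isSymmetric_hermitianDilation f), fun p => h p.fst p.snd⟩⟩

section Comparison

variable {C : WithLp 2 (E × F) →ₗ[𝕜] WithLp 2 (E × F)} {n : ℕ}

theorem singularValues_le_eigenvalues {f : E →ₗ[𝕜] F} (hC : C.IsSymmetric)
    (hfC : hermitianDilation f ≤ C) (hn : finrank 𝕜 (WithLp 2 (E × F)) = n) (i : Fin n)
    (hi : i < finrank 𝕜 E) : f.singularValues i ≤ hC.eigenvalues hn i := by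
  obtain ⟨S, hS, hle⟩ := exists_submodule_singularValues_mul_le f hi
  set s := f.singularValues i
  obtain hs | hs := (f.singularValues_nonneg i : 0 ≤ s).eq_or_lt
  · let J : E →ₗ[𝕜] WithLp 2 (E × F) :=
      (WithLp.linearEquiv 2 𝕜 (E × F)).symm ∘ₗ LinearMap.inl 𝕜 E F
    refine le_eigenvalues_of_injective (J := J) hC hn
      ((toLp_injective 2).comp LinearMap.inl_injective) hi fun x => ?_
    simpa [s, ← hs, J] using (hermitianDilation_le_iff hC).1 hfC x 0
  -- on the image of `x ↦ (σᵢ x, f x)`, `x ∈ S`, the dilation is bounded below by `σᵢ`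
  let J : S →ₗ[𝕜] WithLp 2 (E × F) :=
    (WithLp.linearEquiv 2 𝕜 (E × F)).symm ∘ₗ ((s : 𝕜) • S.subtype).prod (f ∘ₗ S.subtype)
  have hJ : Function.Injective J := fun x y hxy => by
    have : (s : 𝕜) • (x : E) = (s : 𝕜) • (y : E) := congrArg (·.fst) hxy
    exact Subtype.ext (smul_right_injective E (RCLike.ofReal_ne_zero.2 hs.ne') this)
  refine le_eigenvalues_of_injective hC hn hJ (by omega) fun x => ?_
  have hnorm : ‖J x‖ ^ 2 = s ^ 2 * ‖(x : E)‖ ^ 2 + ‖f x‖ ^ 2 := by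
    simp [J, prod_norm_sq_eq_of_L2, norm_smul, mul_pow]
  have hform : 2 * (s * ‖f x‖ ^ 2) ≤ RCLike.re ⟪C (J x), J x⟫_𝕜 := by
    have := (hermitianDilation_le_iff hC).1 hfC ((s : 𝕜) • (x : E)) (f x)
    rwa [map_smul, inner_smul_left, RCLike.conj_ofReal, RCLike.re_ofReal_mul,
      inner_self_eq_norm_sq] at this
  have hsq : s ^ 2 * ‖(x : E)‖ ^ 2 ≤ ‖f x‖ ^ 2 := by
    rw [← mul_pow]
    exact pow_le_pow_left₀ (by positivity) (hle x x.2) 2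
  rw [hnorm]
  nlinarith

theorem neg_singularValues_le_eigenvalues {f : E →ₗ[𝕜] F} (hC : C.IsSymmetric)
    (hfC : hermitianDilation f ≤ C) (hn : finrank 𝕜 (WithLp 2 (E × F)) = n) (i : Fin n) {j : ℕ}
    (hij : i + j < n) : -f.singularValues j ≤ hC.eigenvalues hn i := by
  obtain ⟨S, hS, hle⟩ := exists_submodule_le_singularValues_mul f j
  let J : S × F →ₗ[𝕜] WithLp 2 (E × F) :=
    (WithLp.linearEquiv 2 𝕜 (E × F)).symm ∘ₗ S.subtype.prodMap LinearMap.id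
  have hJ : Function.Injective J := (toLp_injective 2).comp
    (Function.Injective.prodMap S.injective_subtype Function.injective_id)
  have hdim : i < finrank 𝕜 (S × F) := by
    rw [finrank_withLp_prod] at hn
    rw [finrank_prod]
    omega
  refine le_eigenvalues_of_injective hC hn hJ hdim fun ⟨x, y⟩ => ?_
  have hnorm : ‖J (x, y)‖ ^ 2 = ‖(x : E)‖ ^ 2 + ‖y‖ ^ 2 := by simp [J, prod_norm_sq_eq_of_L2]
  have hform : -(2 * (‖f x‖ * ‖y‖)) ≤ RCLike.re ⟪C (J (x, y)), J (x, y)⟫_𝕜 := by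
    refine le_trans ?_ ((hermitianDilation_le_iff hC).1 hfC x y)
    have := (abs_le.1 ((RCLike.abs_re_le_norm _).trans (norm_inner_le_norm (𝕜 := 𝕜) (f x) y))).1
    linarith
  have hf : ‖f x‖ * ‖y‖ ≤ f.singularValues j * (‖(x : E)‖ * ‖y‖) := by
    rw [← mul_assoc]
    exact mul_le_mul_of_nonneg_right (hle x x.2) (norm_nonneg y)
  rw [hnorm]
  nlinarith [two_mul_le_add_sq ‖(x : E)‖ ‖y‖, f.singularValues_nonneg j]

theorem sum_abs_singularValues_sub_le_re_trace {f g : E →ₗ[𝕜] F} (hC : C.IsSymmetric)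
    (hfC : hermitianDilation f ≤ C) (hgC : hermitianDilation g ≤ C) :
    ∑ i ∈ Finset.range (finrank 𝕜 E), |f.singularValues i - g.singularValues i| ≤
      RCLike.re (C.trace 𝕜 _) := by
  set a : ℕ → ℝ := fun i => max (f.singularValues i) (g.singularValues i)
  set b : ℕ → ℝ := fun i => min (f.singularValues i) (g.singularValues i)
  have hb : ∑ j ∈ Finset.range (finrank 𝕜 F), b j ≤ ∑ j ∈ Finset.range (finrank 𝕜 E), b j := by
    calc ∑ j ∈ Finset.range (finrank 𝕜 F), b j
        ≤ ∑ j ∈ Finset.range (max (finrank 𝕜 E) (finrank 𝕜 F)), b j :=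
          Finset.sum_le_sum_of_subset_of_nonneg (Finset.range_mono (le_max_right _ _)) fun j _ _ =>
            le_min (f.singularValues_nonneg j) (g.singularValues_nonneg j)
      _ = ∑ j ∈ Finset.range (finrank 𝕜 E), b j :=
          (Finset.sum_subset (Finset.range_mono (le_max_left _ _)) fun j _ hj => by
            have hj : finrank 𝕜 E ≤ j := by simpa using hj
            simp [b, LinearMap.singularValues_of_finrank_le _ hj]).symm
  rw [hC.re_trace_eq_sum_eigenvalues finrank_withLp_prod, Fin.sum_univ_add]
  calc ∑ i ∈ Finset.range (finrank 𝕜 E), |f.singularValues i - g.singularValues i|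
      = ∑ i ∈ Finset.range (finrank 𝕜 E), a i - ∑ i ∈ Finset.range (finrank 𝕜 E), b i := by
        simp only [a, b, ← Finset.sum_sub_distrib, max_sub_min_eq_abs']
    _ ≤ ∑ i : Fin (finrank 𝕜 E), a i + ∑ j : Fin (finrank 𝕜 F), -b j.rev := by
        have hrev : ∑ j : Fin (finrank 𝕜 F), b j.rev = ∑ j : Fin (finrank 𝕜 F), b j :=
          Equiv.sum_comp Fin.revPerm fun j : Fin (finrank 𝕜 F) => b j
        rw [Finset.sum_neg_distrib, hrev, ← Finset.sum_range, ← Finset.sum_range]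
        linarith
    _ ≤ _ := by
        refine add_le_add (Finset.sum_le_sum fun i _ => ?_) (Finset.sum_le_sum fun j _ => ?_)
        · exact max_le (singularValues_le_eigenvalues hC hfC _ (i.castAdd _) i.2)
            (singularValues_le_eigenvalues hC hgC _ (i.castAdd _) i.2)
        · rw [← max_neg_neg]
          exact max_le (neg_singularValues_le_eigenvalues hC hfC _ _ (by simp; omega))
            (neg_singularValues_le_eigenvalues hC hgC _ _ (by simp; omega))

end Comparison

theorem sum_abs_singularValues_sub_le {ι : Type*} [Fintype ι] {f g : E →ₗ[𝕜] F} {τ : ι → ℝ}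
    (hτ : ∀ i, 0 ≤ τ i) {u : ι → F} (hu : ∀ i, ‖u i‖ ≤ 1) {v : ι → E} (hv : ∀ i, ‖v i‖ ≤ 1)
    (hfg : ∀ x, f x - g x = ∑ i, (τ i : 𝕜) • ⟪v i, x⟫_𝕜 • u i) :
    ∑ i ∈ Finset.range (finrank 𝕜 E), |f.singularValues i - g.singularValues i| ≤ ∑ i, τ i := by
  let w (i : ι) : WithLp 2 (E × F) := toLp 2 (v i, u i)
  let R : WithLp 2 (E × F) →ₗ[𝕜] WithLp 2 (E × F) :=
    ∑ i, ((τ i / 2 : ℝ) : 𝕜) • (rankOne 𝕜 (w i) (w i)).toLinearMap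
  have hC : (hermitianDilation g + R).IsSymmetric :=
    (isSymmetric_hermitianDilation g).add (isSymmetric_sum_smul_rankOne _ w)
  have hform (x y) : RCLike.re ⟪(hermitianDilation g + R) (toLp 2 (x, y)), toLp 2 (x, y)⟫_𝕜 =
      2 * RCLike.re ⟪g x, y⟫_𝕜 + ∑ i, τ i / 2 * ‖⟪v i, x⟫_𝕜 + ⟪u i, y⟫_𝕜‖ ^ 2 := by
    rw [LinearMap.add_apply, inner_add_left, map_add, re_inner_hermitianDilation_apply_self,
      re_inner_sum_smul_rankOne_apply_self]
    rfl
  have hgC : hermitianDilation g ≤ hermitianDilation g + R := by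
    refine (hermitianDilation_le_iff hC).2 fun x y => ?_
    rw [hform, le_add_iff_nonneg_right]
    exact Finset.sum_nonneg fun i _ => mul_nonneg (div_nonneg (hτ i) zero_le_two) (sq_nonneg _)
  have hfC : hermitianDilation f ≤ hermitianDilation g + R := by
    refine (hermitianDilation_le_iff hC).2 fun x y => ?_
    rw [hform, ← sub_le_iff_le_add', ← mul_sub, ← map_sub, ← inner_sub_left, hfg, sum_inner,
      map_sum, Finset.mul_sum]
    refine Finset.sum_le_sum fun i _ => ?_
    rw [inner_smul_left, RCLike.conj_ofReal, RCLike.re_ofReal_mul, inner_smul_left]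
    have h1 := @norm_add_sq 𝕜 𝕜 _ _ _ ⟪v i, x⟫_𝕜 ⟪u i, y⟫_𝕜
    have h2 := @norm_sub_sq 𝕜 𝕜 _ _ _ ⟪v i, x⟫_𝕜 ⟪u i, y⟫_𝕜
    rw [RCLike.inner_apply'] at h1 h2
    nlinarith [hτ i, sq_nonneg ‖⟪v i, x⟫_𝕜 - ⟪u i, y⟫_𝕜‖]
  refine (sum_abs_singularValues_sub_le_re_trace hC hfC hgC).trans ?_
  rw [map_add, trace_hermitianDilation, zero_add, re_trace_sum_smul_rankOne]
  refine Finset.sum_le_sum fun i _ => ?_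
  have hw : ‖w i‖ ^ 2 = ‖v i‖ ^ 2 + ‖u i‖ ^ 2 := prod_norm_sq_eq_of_L2 (w i)
  nlinarith [hτ i, pow_le_one₀ (n := 2) (norm_nonneg _) (hu i),
    pow_le_one₀ (n := 2) (norm_nonneg _) (hv i)]

end Dilation

section SingularValueDecomposition

open Module Matrix
open scoped InnerProductSpace

section Operators

variable {𝕜 E F : Type*} [RCLike 𝕜]
  [NormedAddCommGroup E] [InnerProductSpace 𝕜 E] [FiniteDimensional 𝕜 E]
  [NormedAddCommGroup F] [InnerProductSpace 𝕜 F] [FiniteDimensional 𝕜 F]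

theorem exists_orthonormalBasis_inner_apply (f : E →ₗ[𝕜] F) {n : ℕ} (hn : finrank 𝕜 E = n) :
    ∃ v : OrthonormalBasis (Fin n) 𝕜 E, ∀ i j, ⟪f (v i), f (v j)⟫_𝕜 =
      if i = j then (f.singularValues i : 𝕜) ^ 2 else 0 := by
  have hT := f.isSymmetric_adjoint_comp_self
  refine ⟨hT.eigenvectorBasis hn, fun i j => ?_⟩
  have hj := hT.apply_eigenvectorBasis hn j
  rw [LinearMap.comp_apply] at hj
  rw [← LinearMap.adjoint_inner_right, hj, inner_smul_right,
    orthonormal_iff_ite.1 (hT.eigenvectorBasis hn).orthonormal i j, ← f.sq_singularValues_fin hn]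
  split_ifs with hij <;> simp [hij]

theorem exists_singularValueDecomposition (f : E →ₗ[𝕜] F) {n : ℕ} (hF : finrank 𝕜 F = n)
    (hFE : n ≤ finrank 𝕜 E) :
    ∃ (u : OrthonormalBasis (Fin n) 𝕜 F) (v : Fin n → E), Orthonormal 𝕜 v ∧
      ∀ x, f x = ∑ i : Fin n, (f.singularValues i : 𝕜) • ⟪v i, x⟫_𝕜 • u i := by
  obtain ⟨d, hd⟩ := Nat.exists_eq_add_of_le hFE
  obtain ⟨v, hv⟩ := exists_orthonormalBasis_inner_apply f hd
  have hzero (i : Fin (n + d)) (hi : f.singularValues i = 0) : f (v i) = 0 := by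
    rw [← inner_self_eq_zero (𝕜 := 𝕜), hv, if_pos rfl, hi]
    simp
  -- `uᵢ = σᵢ⁻¹ f vᵢ` is orthonormal on the support of `σ`; the other `uᵢ` are irrelevant
  let s : Set (Fin n) := {i | f.singularValues i ≠ 0}
  let w (i : Fin n) : F := (f.singularValues i : 𝕜)⁻¹ • f (v (i.castAdd d))
  have hw : Orthonormal 𝕜 (s.domRestrict w) := by
    rw [orthonormal_iff_ite]
    rintro ⟨i, hi⟩ ⟨j, hj⟩
    change ⟪w i, w j⟫_𝕜 = _
    have hi' : (f.singularValues i : 𝕜) ≠ 0 := RCLike.ofReal_ne_zero.2 hi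
    rw [inner_smul_left, inner_smul_right, hv]
    by_cases hij : i = j
    · subst hij
      simp only [map_inv₀, RCLike.conj_ofReal, Fin.val_castAdd, if_true]
      field_simp
    · simp [hij]
  obtain ⟨u, hu⟩ := hw.exists_orthonormalBasis_extension_of_card_eq (by simpa using hF)
  have hfv (i : Fin n) : f (v (i.castAdd d)) = (f.singularValues i : 𝕜) • u i := by
    by_cases hi : f.singularValues i = 0
    · rw [hi, RCLike.ofReal_zero, zero_smul, hzero _ hi]
    · rw [hu i hi, smul_inv_smul₀ (RCLike.ofReal_ne_zero.2 hi)]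
  have hfv' (i : Fin d) : f (v (i.natAdd n)) = 0 := hzero _ <|
    f.singularValues_eq_zero_iff_le_finrank_range.2 <|
      (Submodule.finrank_le _).trans (hF.trans_le (Nat.le_add_right n i))
  refine ⟨u, fun i => v (i.castAdd d),
    v.orthonormal.comp _ (Fin.castAdd_injective n d), fun x => ?_⟩
  conv_lhs => rw [← v.sum_repr' x, map_sum, Fin.sum_univ_add]
  simp only [map_smul, hfv, hfv', smul_zero, Finset.sum_const_zero, add_zero,
    smul_comm (f.singularValues _ : 𝕜)]

end Operators

section Matrices

variable {n₁ n₂ : ℕ} {U : Matrix (Fin n₁) (Fin n₁) ℝ} {V : Matrix (Fin n₂) (Fin n₁) ℝ}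
  {X Y : Matrix (Fin n₁) (Fin n₂) ℝ}

theorem orthonormal_col_iff {m n : Type*} [Fintype m] [DecidableEq n] {A : Matrix m n ℝ} :
    Orthonormal ℝ (fun j => WithLp.toLp 2 (A.col j)) ↔ Aᵀ * A = 1 := by
  rw [orthonormal_iff_ite, ← Matrix.ext_iff]
  simp [Matrix.mul_apply, Matrix.one_apply, PiLp.inner_apply, mul_comm]

theorem toEuclideanLin_mul_diagonal_mul_transpose {l m n : Type*} [Fintype m] [Fintype n]
    [DecidableEq m] [DecidableEq n] (U : Matrix l m ℝ) (d : m → ℝ) (V : Matrix n m ℝ)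
    (x : EuclideanSpace ℝ n) :
    (U * diagonal d * Vᵀ).toEuclideanLin x =
      ∑ i, d i • ⟪WithLp.toLp 2 (V.col i), x⟫_ℝ • WithLp.toLp 2 (U.col i) := by
  have hV (i : m) : (Vᵀ *ᵥ x.ofLp) i = ⟪WithLp.toLp 2 (V.col i), x⟫_ℝ := by
    simp [mulVec, dotProduct, PiLp.inner_apply, mul_comm]
  ext j
  rw [toLpLin_apply, ← mulVec_mulVec, ← mulVec_mulVec]
  simp only [mulVec, dotProduct_comm (U j)]
  simp [dotProduct, mulVec_diagonal, hV, mul_assoc]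

theorem exists_svd (hn : n₁ ≤ n₂) (X : Matrix (Fin n₁) (Fin n₂) ℝ) :
    ∃ (U : Matrix (Fin n₁) (Fin n₁) ℝ) (V : Matrix (Fin n₂) (Fin n₁) ℝ), IsUnitaryPair U V ∧
      X = U * diagonal (fun i : Fin n₁ => sigma X i) * Vᵀ := by
  obtain ⟨u, v, hv, hX⟩ := exists_singularValueDecomposition X.toEuclideanLin
    finrank_euclideanSpace_fin (hn.trans_eq finrank_euclideanSpace_fin.symm)
  let U : Matrix (Fin n₁) (Fin n₁) ℝ := of fun i j => u j i
  let V : Matrix (Fin n₂) (Fin n₁) ℝ := of fun i j => v j i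
  have hU : Uᵀ * U = 1 := orthonormal_col_iff.1 u.orthonormal
  refine ⟨U, V, ⟨hU, mul_eq_one_comm.1 hU, orthonormal_col_iff.1 hv⟩, ?_⟩
  refine Matrix.toEuclideanLin.injective (LinearMap.ext fun x => ?_)
  rw [hX, toEuclideanLin_mul_diagonal_mul_transpose]
  rfl

theorem sigma_nonneg (X : Matrix (Fin n₁) (Fin n₂) ℝ) (i : ℕ) : 0 ≤ sigma X i :=
  X.toEuclideanLin.singularValues_nonneg i

theorem norm_col_le_one {m n : Type*} [Fintype m] [DecidableEq n] {A : Matrix m n ℝ}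
    (hA : Aᵀ * A = 1) (j : n) : ‖WithLp.toLp 2 (A.col j)‖ ≤ 1 :=
  ((orthonormal_col_iff.2 hA).1 j).le

theorem sum_abs_sigma_sub_le (hn : n₁ ≤ n₂) (hUV : IsUnitaryPair U V) {d : Fin n₁ → ℝ}
    (hd : ∀ i, 0 ≤ d i) (hXY : X - Y = U * diagonal d * Vᵀ) :
    ∑ i : Fin n₁, |sigma X i - sigma Y i| ≤ ∑ i, d i := by
  rw [← Finset.sum_range fun i => |sigma X i - sigma Y i|]
  refine (Finset.sum_le_sum_of_subset_of_nonneg ?_ fun _ _ _ => abs_nonneg _).trans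
    (sum_abs_singularValues_sub_le hd (norm_col_le_one hUV.1) (norm_col_le_one hUV.2.2)
      fun x => ?_)
  · rw [finrank_euclideanSpace_fin]
    exact Finset.range_mono hn
  · rw [← LinearMap.sub_apply, ← map_sub, hXY]
    exact toEuclideanLin_mul_diagonal_mul_transpose U d V x

theorem sum_abs_sigma_sub_le_nuclearNorm (hn : n₁ ≤ n₂) (X Y : Matrix (Fin n₁) (Fin n₂) ℝ) :
    ∑ i : Fin n₁, |sigma X i - sigma Y i| ≤ nuclearNorm (X - Y) := by
  obtain ⟨U, V, hUV, h⟩ := exists_svd hn (X - Y)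
  exact sum_abs_sigma_sub_le hn hUV (fun i => sigma_nonneg _ i) h

theorem sigma_zero (i : ℕ) : sigma (0 : Matrix (Fin n₁) (Fin n₂) ℝ) i = 0 := by
  simp [sigma]

theorem nuclearNorm_mul_diagonal_mul_transpose_le (hn : n₁ ≤ n₂) (hUV : IsUnitaryPair U V)
    {d : Fin n₁ → ℝ} (hd : ∀ i, 0 ≤ d i) :
    nuclearNorm (U * diagonal d * Vᵀ) ≤ ∑ i, d i := by
  have := sum_abs_sigma_sub_le (Y := 0) hn hUV hd (sub_zero _)
  simpa only [nuclearNorm, sigma_zero, sub_zero, abs_of_nonneg (sigma_nonneg _ _)] using this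

theorem sigma_eq_zero_of_rank_le {i : ℕ} (h : X.rank ≤ i) : sigma X i = 0 := by
  rw [sigma, LinearMap.singularValues_eq_zero_iff_le_finrank_range]
  rwa [Matrix.rank_eq_finrank_range_toLin _ (PiLp.basisFun 2 ℝ _) (PiLp.basisFun 2 ℝ _)] at h

end Matrices

end SingularValueDecomposition

section Compression

open Matrix
open scoped Matrix.Norms.Frobenius

variable {m n₁ n₂ : ℕ} {𝒜 : MeasOp m n₁ n₂} {U : Matrix (Fin n₁) (Fin n₁) ℝ}
  {V : Matrix (Fin n₂) (Fin n₁) ℝ}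

theorem frobNorm_eq_norm (X : Matrix (Fin n₁) (Fin n₂) ℝ) : frobNorm X = ‖X‖ := by
  simp [frobNorm, frobenius_norm_def, Real.sqrt_eq_rpow]

theorem exists_norm_apply_le_mul_frobNorm (𝒜 : MeasOp m n₁ n₂) :
    ∃ K : ℝ, 0 ≤ K ∧ ∀ X, ‖𝒜 X‖ ≤ K * frobNorm X := by
  obtain ⟨K, hK, hbound⟩ := SemilinearMapClass.bound_of_continuous 𝒜
    (LinearMap.continuous_of_finiteDimensional 𝒜)
  exact ⟨K, hK.le, fun X => frobNorm_eq_norm X ▸ hbound X⟩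

theorem frobNorm_nonneg (X : Matrix (Fin n₁) (Fin n₂) ℝ) : 0 ≤ frobNorm X := Real.sqrt_nonneg _

theorem frobNorm_sq_eq_trace (X : Matrix (Fin n₁) (Fin n₂) ℝ) :
    frobNorm X ^ 2 = (X * Xᵀ).trace := by
  rw [frobNorm, Real.sq_sqrt (by positivity)]
  simp [trace, mul_apply, sq]

theorem opRIC_set_nonempty (𝒜 : MeasOp m n₁ n₂) (k : ℕ) :
    {δ : ℝ | 0 ≤ δ ∧ ∀ X : Matrix (Fin n₁) (Fin n₂) ℝ, X.rank ≤ k →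
      (1 - δ) * frobNorm X ^ 2 ≤ ‖𝒜 X‖ ^ 2 ∧
        ‖𝒜 X‖ ^ 2 ≤ (1 + δ) * frobNorm X ^ 2}.Nonempty := by
  obtain ⟨K, -, hbound⟩ := exists_norm_apply_le_mul_frobNorm 𝒜
  refine ⟨1 + K ^ 2, by positivity, fun X _ => ⟨?_, ?_⟩⟩
  · nlinarith [sq_nonneg ‖𝒜 X‖, mul_nonneg (sq_nonneg K) (sq_nonneg (frobNorm X))]
  · nlinarith [pow_le_pow_left₀ (norm_nonneg _) (hbound X) 2, sq_nonneg (frobNorm X)]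

theorem opROC_set_nonempty (𝒜 : MeasOp m n₁ n₂) (k k' : ℕ) :
    {θ : ℝ | 0 ≤ θ ∧ ∀ X X' : Matrix (Fin n₁) (Fin n₂) ℝ, X.rank ≤ k → X'.rank ≤ k' →
      Xᵀ * X' = 0 → X * X'ᵀ = 0 →
        |inner ℝ (𝒜 X) (𝒜 X')| ≤ θ * frobNorm X * frobNorm X'}.Nonempty := by
  obtain ⟨K, hK, hbound⟩ := exists_norm_apply_le_mul_frobNorm 𝒜
  refine ⟨K * K, by positivity, fun X X' _ _ _ _ => ?_⟩
  calc |inner ℝ (𝒜 X) (𝒜 X')| ≤ ‖𝒜 X‖ * ‖𝒜 X'‖ := abs_real_inner_le_norm _ _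
    _ ≤ (K * frobNorm X) * (K * frobNorm X') :=
      mul_le_mul (hbound X) (hbound X') (norm_nonneg _)
        ((norm_nonneg _).trans (hbound X))
    _ = K * K * frobNorm X * frobNorm X' := by ring

/-- The linear embedding `x ↦ U diag(x) Vᵀ`; for a unitary pair it identifies `ℝ^{n₁}` with the
matrices whose singular vectors are the columns of `U` and `V`. -/
noncomputable def diagonalEmbedding (U : Matrix (Fin n₁) (Fin n₁) ℝ)
    (V : Matrix (Fin n₂) (Fin n₁) ℝ) : Vec n₁ →ₗ[ℝ] Matrix (Fin n₁) (Fin n₂) ℝ where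
  toFun x := U * diagonal x.ofLp * Vᵀ
  map_add' x y := by
    rw [← Matrix.add_mul, ← Matrix.mul_add, diagonal_add]
    rfl
  map_smul' c x := by simp [diagonal_smul]

theorem diagonalEmbedding_apply (U : Matrix (Fin n₁) (Fin n₁) ℝ) (V : Matrix (Fin n₂) (Fin n₁) ℝ)
    (x : Vec n₁) : diagonalEmbedding U V x = U * diagonal x.ofLp * Vᵀ := rfl

theorem diagonalEmbedding_mul_transpose (hV : Vᵀ * V = 1) (x y : Vec n₁) :
    diagonalEmbedding U V x * (diagonalEmbedding U V y)ᵀ =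
      U * (diagonal x.ofLp * diagonal y.ofLp) * Uᵀ := by
  calc _ = U * diagonal x.ofLp * (Vᵀ * V) * diagonal y.ofLp * Uᵀ := by
        simp only [diagonalEmbedding_apply, transpose_mul, diagonal_transpose,
          transpose_transpose, Matrix.mul_assoc]
    _ = _ := by rw [hV, Matrix.mul_one, Matrix.mul_assoc U]

theorem transpose_diagonalEmbedding_mul (hU : Uᵀ * U = 1) (x y : Vec n₁) :
    (diagonalEmbedding U V x)ᵀ * diagonalEmbedding U V y =
      V * (diagonal x.ofLp * diagonal y.ofLp) * Vᵀ := by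
  calc _ = V * diagonal x.ofLp * (Uᵀ * U) * diagonal y.ofLp * Vᵀ := by
        simp only [diagonalEmbedding_apply, transpose_mul, diagonal_transpose,
          transpose_transpose, Matrix.mul_assoc]
    _ = _ := by rw [hU, Matrix.mul_one, Matrix.mul_assoc V]

theorem IsUnitaryPair.frobNorm_diagonalEmbedding (h : IsUnitaryPair U V) (x : Vec n₁) :
    frobNorm (diagonalEmbedding U V x) = ‖x‖ := by
  refine (sq_eq_sq₀ (frobNorm_nonneg _) (norm_nonneg x)).1 ?_
  rw [frobNorm_sq_eq_trace, diagonalEmbedding_mul_transpose h.2.2, trace_mul_cycle, h.1,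
    Matrix.one_mul, diagonal_mul_diagonal, trace_diagonal, EuclideanSpace.real_norm_sq_eq]
  simp only [sq]

theorem rank_diagonalEmbedding_le (U : Matrix (Fin n₁) (Fin n₁) ℝ)
    (V : Matrix (Fin n₂) (Fin n₁) ℝ) (x : Vec n₁) :
    (diagonalEmbedding U V x).rank ≤ nnzCount x := by
  classical
  calc (U * diagonal x.ofLp * Vᵀ).rank ≤ (U * diagonal x.ofLp).rank := rank_mul_le_left _ _
    _ ≤ (diagonal x.ofLp).rank := rank_mul_le_right _ _
    _ = nnzCount x := by rw [rank_diagonal, Fintype.card_subtype, nnzCount]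

/-- The matrix of the restriction of a measurement operator to the matrices `U diag(x) Vᵀ`. -/
noncomputable def compression (𝒜 : MeasOp m n₁ n₂) (U : Matrix (Fin n₁) (Fin n₁) ℝ)
    (V : Matrix (Fin n₂) (Fin n₁) ℝ) : Matrix (Fin m) (Fin n₁) ℝ :=
  Matrix.toEuclideanLin.symm (𝒜 ∘ₗ diagonalEmbedding U V)

theorem compression_apply (𝒜 : MeasOp m n₁ n₂) (U : Matrix (Fin n₁) (Fin n₁) ℝ)
    (V : Matrix (Fin n₂) (Fin n₁) ℝ) (x : Vec n₁) :
    (compression 𝒜 U V).toEuclideanLin x = 𝒜 (diagonalEmbedding U V x) := by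
  rw [compression, LinearEquiv.apply_symm_apply, LinearMap.comp_apply]

theorem vecRIC_compression_le (𝒜 : MeasOp m n₁ n₂) (h : IsUnitaryPair U V) (k : ℕ) :
    vecRIC (compression 𝒜 U V) k ≤ opRIC 𝒜 k := by
  refine csInf_le_csInf ⟨0, fun _ h => h.1⟩ (opRIC_set_nonempty 𝒜 k) ?_
  rintro δ ⟨hδ, hX⟩
  refine ⟨hδ, fun x hx => ?_⟩
  rw [compression_apply, ← h.frobNorm_diagonalEmbedding]
  exact hX _ ((rank_diagonalEmbedding_le U V x).trans hx)

theorem vecROC_compression_le (𝒜 : MeasOp m n₁ n₂) (h : IsUnitaryPair U V) (k k' : ℕ) :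
    vecROC (compression 𝒜 U V) k k' ≤ opROC 𝒜 k k' := by
  refine csInf_le_csInf ⟨0, fun _ h => h.1⟩ (opROC_set_nonempty 𝒜 k k') ?_
  rintro θ ⟨hθ, hX⟩
  refine ⟨hθ, fun x x' hx hx' hdisj => ?_⟩
  have hzero : diagonal x.ofLp * diagonal x'.ofLp = 0 := by
    rw [diagonal_mul_diagonal, diagonal_eq_zero]
    exact funext fun i => mul_eq_zero.2 (hdisj i)
  rw [compression_apply, compression_apply, ← h.frobNorm_diagonalEmbedding x,
    ← h.frobNorm_diagonalEmbedding x']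
  refine hX _ _ ((rank_diagonalEmbedding_le U V x).trans hx)
    ((rank_diagonalEmbedding_le U V x').trans hx') ?_ ?_
  · rw [transpose_diagonalEmbedding_mul h.1, hzero, Matrix.mul_zero, Matrix.zero_mul]
  · rw [diagonalEmbedding_mul_transpose h.2.2, hzero, Matrix.mul_zero, Matrix.zero_mul]

theorem OpSatisfies.vecSatisfies_compression {F : Set RIPInequality} (hF : OpSatisfies F 𝒜)
    (h : IsUnitaryPair U V) : VecSatisfies F (compression 𝒜 U V) := fun I hI =>
  (I.mono _ _ _ _ (fun _ => Real.sInf_nonneg fun _ h => h.1)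
    (fun _ => vecRIC_compression_le 𝒜 h _) (fun _ => Real.sInf_nonneg fun _ h => h.1)
    (fun _ => vecROC_compression_le 𝒜 h _ _)).trans (hF I hI)

end Compression

section Transfer

open Matrix

variable {m n₁ n₂ : ℕ} {𝒜 : MeasOp m n₁ n₂} {X Y X₀ X' : Matrix (Fin n₁) (Fin n₂) ℝ} {k : ℕ}
  {ε : ℝ}

/-- The vector of the `n₁` largest singular values, in decreasing order. -/
noncomputable def sigmaVec (X : Matrix (Fin n₁) (Fin n₂) ℝ) : Vec n₁ :=
  WithLp.toLp 2 fun i => sigma X i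

theorem l1Norm_sigmaVec (X : Matrix (Fin n₁) (Fin n₂) ℝ) :
    l1Norm (sigmaVec X) = nuclearNorm X :=
  Finset.sum_congr rfl fun i _ => abs_of_nonneg (sigma_nonneg X i)

theorem exists_eq_diagonalEmbedding_sigmaVec (hn : n₁ ≤ n₂) (X : Matrix (Fin n₁) (Fin n₂) ℝ) :
    ∃ U V, IsUnitaryPair U V ∧ X = diagonalEmbedding U V (sigmaVec X) :=
  exists_svd hn X

theorem norm_sigmaVec (hn : n₁ ≤ n₂) (X : Matrix (Fin n₁) (Fin n₂) ℝ) :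
    ‖sigmaVec X‖ = frobNorm X := by
  obtain ⟨U, V, hUV, hX⟩ := exists_eq_diagonalEmbedding_sigmaVec hn X
  rw [← hUV.frobNorm_diagonalEmbedding, ← hX]

theorem IsSVDTruncation.rank_le (h : IsSVDTruncation X k Y) : Y.rank ≤ k := by
  obtain ⟨U, V, -, -, hY⟩ := h
  rw [hY]
  calc _ ≤ nnzCount (WithLp.toLp 2 fun i : Fin n₁ => if (i : ℕ) < k then sigma X i else 0) :=
        rank_diagonalEmbedding_le U V _
    _ ≤ (Finset.univ.filter fun i : Fin n₁ => (i : ℕ) < k).card :=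
        Finset.card_le_card fun i => by simp +contextual
    _ ≤ k := by simp [Fin.card_filter_val_lt]

theorem IsSVDTruncation.nuclearNorm_sub (hn : n₁ ≤ n₂) (h : IsSVDTruncation X k Y) :
    nuclearNorm (X - Y) = ∑ i : Fin n₁, if (i : ℕ) < k then 0 else sigma X i := by
  have hrank := h.rank_le
  obtain ⟨U, V, hUV, hX, hY⟩ := h
  refine le_antisymm ?_ ?_
  · have hXY : X - Y =
        U * diagonal (fun i : Fin n₁ => if (i : ℕ) < k then 0 else sigma X i) * Vᵀ := by
      conv_lhs => rw [hY]; enter [1]; rw [hX]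
      rw [← Matrix.sub_mul, ← Matrix.mul_sub, diagonal_sub]
      congr! 4 with i
      split_ifs <;> simp
    rw [hXY]
    refine nuclearNorm_mul_diagonal_mul_transpose_le hn hUV fun i => ?_
    split_ifs
    exacts [le_rfl, sigma_nonneg X i]
  · refine (Finset.sum_le_sum fun i _ => ?_).trans (sum_abs_sigma_sub_le_nuclearNorm hn X Y)
    split_ifs with hi
    · exact abs_nonneg _
    · rw [sigma_eq_zero_of_rank_le (hrank.trans (not_lt.1 hi)), sub_zero]
      exact le_abs_self _

theorem IsSVDTruncation.exists_isTopRestriction (hn : n₁ ≤ n₂) (h : IsSVDTruncation X k Y) :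
    ∃ y, IsTopRestriction (sigmaVec X) k y ∧ l1Norm (sigmaVec X - y) = nuclearNorm (X - Y) := by
  refine ⟨WithLp.toLp 2 fun i => if (i : ℕ) < k then sigma X i else 0,
    ⟨Finset.univ.filter fun i => (i : ℕ) < k, ?_, fun i hi j hj => ?_, fun i => ?_⟩, ?_⟩
  · rw [Fin.card_filter_val_lt, min_comm]
  · simp only [Finset.mem_filter, Finset.mem_univ, true_and, not_lt] at hi hj
    change |sigma X j| ≤ |sigma X i|
    rw [abs_of_nonneg (sigma_nonneg _ _), abs_of_nonneg (sigma_nonneg _ _)]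
    exact X.toEuclideanLin.singularValues_antitone (hi.le.trans hj)
  · simp [sigmaVec]
  · rw [h.nuclearNorm_sub hn]
    refine Finset.sum_congr rfl fun i _ => ?_
    simp only [sigmaVec, PiLp.sub_apply]
    split_ifs <;> simp [abs_of_nonneg (sigma_nonneg X i)]

theorem MatAsGood.exists_vecAsGood (hn : n₁ ≤ n₂) {z : Vec m}
    (h : MatAsGood 𝒜 ε (𝒜 X₀ + z) X₀ X') :
    ∃ U V, IsUnitaryPair U V ∧
      VecAsGood (compression 𝒜 U V) ε ((compression 𝒜 U V).toEuclideanLin (sigmaVec X₀) + z)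
        (sigmaVec X₀) (sigmaVec X₀ - sigmaVec (X₀ - X')) := by
  obtain ⟨U, V, hUV, hW⟩ := exists_eq_diagonalEmbedding_sigmaVec hn (X₀ - X')
  refine ⟨U, V, hUV, ?_, ?_⟩
  · rw [map_sub, compression_apply 𝒜 U V (sigmaVec (X₀ - X')), ← hW, map_sub]
    convert h.1 using 2
    abel
  · calc l1Norm (sigmaVec X₀ - sigmaVec (X₀ - X'))
        ≤ nuclearNorm (X₀ - (X₀ - X')) := sum_abs_sigma_sub_le_nuclearNorm hn X₀ (X₀ - X')
      _ ≤ nuclearNorm X₀ := by rw [sub_sub_cancel]; exact h.2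
      _ = l1Norm (sigmaVec X₀) := (l1Norm_sigmaVec X₀).symm

theorem matFrobRobust_of_compression (hn : n₁ ≤ n₂) {C₁ C₂ : ℝ}
    (h : ∀ U V, IsUnitaryPair U V → VecL2Robust (compression 𝒜 U V) k ε C₁ C₂) :
    MatFrobRobust 𝒜 k ε C₁ C₂ := by
  intro X₀ X' Xk z hz hgood hk
  obtain ⟨U, V, hUV, hx⟩ := hgood.exists_vecAsGood hn
  obtain ⟨xk, hxk, htail⟩ := hk.exists_isTopRestriction hn
  simpa only [sub_sub_cancel, norm_sigmaVec hn, htail] using h U V hUV _ _ xk z hz hx hxk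

theorem matNuclearRobust_of_compression (hn : n₁ ≤ n₂) {C₃ : ℝ}
    (h : ∀ U V, IsUnitaryPair U V → VecL1Robust (compression 𝒜 U V) k ε C₃) :
    MatNuclearRobust 𝒜 k ε C₃ := by
  intro X₀ X' Xk z hz hgood hk
  obtain ⟨U, V, hUV, hx⟩ := hgood.exists_vecAsGood hn
  obtain ⟨xk, hxk, htail⟩ := hk.exists_isTopRestriction hn
  simpa only [sub_sub_cancel, l1Norm_sigmaVec, htail] using h U V hUV _ _ xk z hz hx hxk

end Transfer

section CappedCube

theorem eq_zero_of_add_sub_mem {E : Type*} [AddCommGroup E] [Module ℝ E] {K : Set E} {w v : E}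
    (hw : w ∈ K.extremePoints ℝ) (hadd : w + v ∈ K) (hsub : w - v ∈ K) : v = 0 := by
  have hseg : w ∈ openSegment ℝ (w + v) (w - v) :=
    ⟨1 / 2, 1 / 2, by norm_num, by norm_num, by norm_num, by module⟩
  simpa using hw.2 hadd hsub hseg

theorem add_single_mem_Icc {ι : Type*} [DecidableEq ι] {w : ι → ℝ} (hw : w ∈ Set.Icc 0 1) {i : ι}
    {t : ℝ} (h0 : -w i ≤ t) (h1 : t ≤ 1 - w i) : w + Pi.single i t ∈ Set.Icc (0 : ι → ℝ) 1 := by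
  refine ⟨fun l => ?_, fun l => ?_⟩ <;> obtain rfl | hl := eq_or_ne l i
  · simpa using neg_le_iff_add_nonneg'.1 h0
  · simpa [hl] using hw.1 l
  · simpa using by linarith
  · simpa [hl] using hw.2 l

theorem add_single_sub_single_mem_Icc {ι : Type*} [DecidableEq ι] {w : ι → ℝ}
    (hw : w ∈ Set.Icc 0 1) {i j : ι} (hij : j ≠ i) {t : ℝ} (hi0 : -w i ≤ t) (hi1 : t ≤ 1 - w i)
    (hj0 : -w j ≤ -t) (hj1 : -t ≤ 1 - w j) :
    w + (Pi.single i t - Pi.single j t) ∈ Set.Icc (0 : ι → ℝ) 1 := by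
  have hval : (w + Pi.single i t : ι → ℝ) j = w j := by simp [hij]
  rw [← add_sub_assoc, sub_eq_add_neg, ← Pi.single_neg]
  exact add_single_mem_Icc (add_single_mem_Icc hw hi0 hi1) (by rwa [hval]) (by rwa [hval])

variable {ι : Type*} [Fintype ι]

/-- The points of the cube `[0, 1]^ι` whose coordinate sum is at most `s`; they are the weights
with which a bound on `s`-sparse vectors can be averaged. -/
def cappedCube (ι : Type*) [Fintype ι] (s : ℕ) : Set (ι → ℝ) :=
  Set.Icc 0 1 ∩ {w | ∑ i, w i ≤ s}

theorem convex_cappedCube (s : ℕ) : Convex ℝ (cappedCube ι s) :=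
  (convex_Icc 0 1).inter <| convex_halfSpace_le
    (f := fun w : ι → ℝ => ∑ i, w i) ⟨fun _ _ => Finset.sum_add_distrib,
      fun _ _ => (Finset.mul_sum _ _ _).symm⟩ _

theorem isCompact_cappedCube (s : ℕ) : IsCompact (cappedCube ι s) :=
  isCompact_Icc.inter_right <| isClosed_le
    (continuous_finsetSum _ fun i _ => continuous_apply i) continuous_const

theorem sum_add_one_sub_le_of_forall_ne {s : ℕ} {w : ι → ℝ} (hs : ∑ l, w l ≤ s) {i : ι}
    (hi : 0 < w i) (hint : ∀ j ≠ i, w j = 0 ∨ w j = 1) : ∑ l, w l + (1 - w i) ≤ s := by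
  classical
  have hcount : ∑ l ∈ Finset.univ.erase i, w l =
      ((Finset.univ.erase i).filter fun l => w l = 1).card := by
    rw [Finset.card_filter, Nat.cast_sum]
    refine Finset.sum_congr rfl fun l hl => ?_
    obtain h | h := hint l (Finset.ne_of_mem_erase hl) <;> simp [h]
  rw [← Finset.add_sum_erase _ _ (Finset.mem_univ i), hcount] at hs ⊢
  have hlt : ((Finset.univ.erase i).filter fun l => w l = 1).card < s := by
    exact_mod_cast (lt_add_of_pos_left _ hi).trans_le hs
  have hle : (((Finset.univ.erase i).filter fun l => w l = 1).card : ℝ) + 1 ≤ s := by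
    exact_mod_cast hlt
  linarith

theorem apply_eq_zero_or_one_of_mem_extremePoints {s : ℕ} {w : ι → ℝ}
    (hw : w ∈ (cappedCube ι s).extremePoints ℝ) (i : ι) : w i = 0 ∨ w i = 1 := by
  classical
  obtain ⟨⟨hIcc, hsum⟩, -⟩ := id hw
  rw [Set.mem_ofPred_eq] at hsum
  by_contra! hfrac
  have hi0 : 0 < w i := (hIcc.1 i).lt_of_ne' hfrac.1
  have hi1 : w i < 1 := (hIcc.2 i).lt_of_ne hfrac.2
  by_cases hint : ∀ j ≠ i, w j = 0 ∨ w j = 1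
  · obtain ⟨a, ha, hai⟩ := exists_between (lt_min hi0 (sub_pos.2 hi1))
    obtain ⟨ha0, ha1⟩ := lt_min_iff.1 hai
    have hroom := sum_add_one_sub_le_of_forall_ne hsum hi0 hint
    have hv := eq_zero_of_add_sub_mem (v := Pi.single i a) hw
      ⟨add_single_mem_Icc hIcc (by linarith) ha1.le, by
        simpa [Finset.sum_add_distrib] using by linarith⟩
      ⟨by rw [sub_eq_add_neg, ← Pi.single_neg]
          exact add_single_mem_Icc hIcc (by linarith) (by linarith), by
        simpa using by linarith⟩
    exact ha.ne' (Pi.single_eq_zero_iff.1 hv)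
  · push Not at hint
    obtain ⟨j, hij, hj⟩ := hint
    have hj0 : 0 < w j := (hIcc.1 j).lt_of_ne' hj.1
    have hj1 : w j < 1 := (hIcc.2 j).lt_of_ne hj.2
    obtain ⟨a, ha, hab⟩ := exists_between
      (lt_min (lt_min hi0 (sub_pos.2 hi1)) (lt_min hj0 (sub_pos.2 hj1)))
    simp only [lt_min_iff] at hab
    obtain ⟨⟨hai0, hai1⟩, haj0, haj1⟩ := hab
    have hv := eq_zero_of_add_sub_mem (v := Pi.single i a - Pi.single j a) hw
      ⟨add_single_sub_single_mem_Icc hIcc hij (by linarith) hai1.le (by linarith)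
        (by linarith), by simpa [Finset.sum_add_distrib] using hsum⟩
      ⟨by rw [sub_eq_add_neg, neg_sub]
          exact add_single_sub_single_mem_Icc hIcc hij.symm (by linarith) haj1.le (by linarith)
            (by linarith), by simpa using hsum⟩
    exact ha.ne' (by simpa [hij] using congrFun hv i)

theorem cappedCube_subset_convexHull (s : ℕ) : cappedCube ι s ⊆
    convexHull ℝ ((fun S : Finset ι => Set.indicator (S : Set ι) 1) '' {S | S.card ≤ s}) := by
  classical
  rw [← closure_convexHull_extremePoints (isCompact_cappedCube s) (convex_cappedCube s)]
  refine closure_minimal (convexHull_mono fun w hw => ?_)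
    ((Set.toFinite _).isClosed_convexHull ℝ)
  have hw01 := apply_eq_zero_or_one_of_mem_extremePoints hw
  have hindicator : Set.indicator ↑(Finset.univ.filter fun i => w i = 1) 1 = w := by
    ext i
    obtain h | h := hw01 i <;> simp [h]
  refine ⟨Finset.univ.filter fun i => w i = 1, ?_, hindicator⟩
  have hsum : ∑ i, w i ≤ s := hw.1.2
  rw [← hindicator] at hsum
  simpa [Set.indicator_apply] using hsum

theorem sq_le_of_mem_cappedCube {s : ℕ} {L M : (ι → ℝ) →ₗ[ℝ] ℝ}
    (h : ∀ S : Finset ι, S.card ≤ s →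
      L (Set.indicator (S : Set ι) 1) ^ 2 ≤ M (Set.indicator (S : Set ι) 1))
    {w : ι → ℝ} (hw : w ∈ cappedCube ι s) : L w ^ 2 ≤ M w := by
  have hconv : ConvexOn ℝ Set.univ fun w => L w ^ 2 - M w :=
    ((even_two.convexOn_pow (𝕜 := ℝ)).comp_linearMap L).sub (M.concaveOn convex_univ)
  obtain ⟨-, ⟨S, hS, rfl⟩, hle⟩ :=
    hconv.exists_ge_of_mem_convexHull (Set.subset_univ _) (cappedCube_subset_convexHull s hw)
  linarith [h S hS]

end CappedCube

section RestrictedIsometry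

variable {E : Type*} [NormedAddCommGroup E] [InnerProductSpace ℝ E] {n : ℕ} {T : Vec n →ₗ[ℝ] E}

/-- `δ` is admissible in the definition of the restricted isometry constant `δ_k` of `T`. -/
def IsometryBound (T : Vec n →ₗ[ℝ] E) (k : ℕ) (δ : ℝ) : Prop :=
  ∀ x, nnzCount x ≤ k → (1 - δ) * ‖x‖ ^ 2 ≤ ‖T x‖ ^ 2 ∧ ‖T x‖ ^ 2 ≤ (1 + δ) * ‖x‖ ^ 2

/-- `θ` is admissible in the definition of the restricted orthogonality constant `θ_{k,k'}`
of `T`. -/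
def OrthoBound (T : Vec n →ₗ[ℝ] E) (k k' : ℕ) (θ : ℝ) : Prop :=
  ∀ x y, nnzCount x ≤ k → nnzCount y ≤ k' → (∀ i, x i = 0 ∨ y i = 0) →
    |inner ℝ (T x) (T y)| ≤ θ * ‖x‖ * ‖y‖

theorem IsometryBound.of_le {k l : ℕ} {δ : ℝ} (h : IsometryBound T k δ) (hl : l ≤ k) :
    IsometryBound T l δ :=
  fun x hx => h x (hx.trans hl)

theorem isometryBound_of_vecRIC_lt {m k : ℕ} {A : Matrix (Fin m) (Fin n) ℝ} {δ : ℝ}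
    (h : vecRIC A k < δ) : IsometryBound A.toEuclideanLin k δ := by
  have hne : {δ : ℝ | 0 ≤ δ ∧ IsometryBound A.toEuclideanLin k δ}.Nonempty := by
    set K := ‖LinearMap.toContinuousLinearMap A.toEuclideanLin‖
    have hbound : ∀ x, ‖A.toEuclideanLin x‖ ^ 2 ≤ K ^ 2 * ‖x‖ ^ 2 := fun x => by
      rw [← mul_pow]
      exact pow_le_pow_left₀ (norm_nonneg _)
        ((LinearMap.toContinuousLinearMap A.toEuclideanLin).le_opNorm x) 2
    refine ⟨1 + K ^ 2, by positivity, fun x _ => ⟨?_, ?_⟩⟩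
    · linarith [sq_nonneg ‖A.toEuclideanLin x‖, mul_nonneg (sq_nonneg K) (sq_nonneg ‖x‖)]
    · linarith [hbound x, sq_nonneg ‖x‖]
  obtain ⟨δ', ⟨-, hδ'⟩, hlt⟩ := exists_lt_of_csInf_lt hne h
  intro x hx
  have hle : δ' * ‖x‖ ^ 2 ≤ δ * ‖x‖ ^ 2 := by gcongr
  constructor <;> linarith [(hδ' x hx).1, (hδ' x hx).2]

theorem nnzCount_smul_le (c : ℝ) (x : Vec n) : nnzCount (c • x) ≤ nnzCount x :=
  Finset.card_le_card <| Finset.monotone_filter_right _ fun _ _ => right_ne_zero_of_mul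

theorem nnzCount_add_le (x y : Vec n) : nnzCount (x + y) ≤ nnzCount x + nnzCount y := by
  classical
  refine (Finset.card_le_card fun i hi => ?_).trans (Finset.card_union_le _ _)
  have hne : x i + y i ≠ 0 := (Finset.mem_filter.1 hi).2
  simp only [Finset.mem_union, Finset.mem_filter_univ]
  by_contra! h
  exact hne (by rw [h.1, h.2, add_zero])

theorem inner_eq_zero_of_disjoint {x y : Vec n} (h : ∀ i, x i = 0 ∨ y i = 0) :
    inner ℝ x y = 0 := by
  rw [PiLp.inner_apply]
  exact Finset.sum_eq_zero fun i _ => by obtain h | h := h i <;> simp [h]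

theorem IsometryBound.two_mul_abs_inner_le {k : ℕ} {δ : ℝ} (h : IsometryBound T k δ) {x y : Vec n}
    (hxy : nnzCount x + nnzCount y ≤ k) (hd : ∀ i, x i = 0 ∨ y i = 0) :
    2 * |inner ℝ (T x) (T y)| ≤ δ * (‖x‖ ^ 2 + ‖y‖ ^ 2) := by
  have hadd := h (x + y) ((nnzCount_add_le x y).trans hxy)
  have hsub := h (x + -1 • y) ((nnzCount_add_le _ _).trans
    ((Nat.add_le_add_left (by simpa using nnzCount_smul_le (-1) y) _).trans hxy))
  rw [neg_one_smul, ← sub_eq_add_neg] at hsub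
  rw [map_add, norm_add_sq_real, norm_add_sq_real, inner_eq_zero_of_disjoint hd] at hadd
  rw [map_sub, norm_sub_sq_real, norm_sub_sq_real, inner_eq_zero_of_disjoint hd] at hsub
  rw [← abs_two (α := ℝ), ← abs_mul, abs_le]
  constructor <;> linarith

theorem IsometryBound.orthoBound {k p q : ℕ} {δ : ℝ} (h : IsometryBound T k δ) (hpq : p + q ≤ k) :
    OrthoBound T p q δ := by
  intro x y hx hy hd
  obtain rfl | hx0 := eq_or_ne x 0
  · simp
  obtain rfl | hy0 := eq_or_ne y 0
  · simp
  -- `‖y‖ • x` and `‖x‖ • y` have the same norm, so nothing is lost in the arithmetic mean.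
  have hscaled := h.two_mul_abs_inner_le (x := ‖y‖ • x) (y := ‖x‖ • y)
    ((Nat.add_le_add ((nnzCount_smul_le _ _).trans hx) ((nnzCount_smul_le _ _).trans hy)).trans
      hpq) fun i => (hd i).imp (by simp [·]) (by simp [·])
  simp only [map_smul, inner_smul_left, inner_smul_right, norm_smul, norm_norm, abs_mul, abs_norm,
    conj_trivial] at hscaled
  have hpos : 0 < ‖x‖ * ‖y‖ := mul_pos (norm_pos_iff.2 hx0) (norm_pos_iff.2 hy0)
  refine le_of_mul_le_mul_left ?_ hpos
  linarith

theorem OrthoBound.mono {k k' : ℕ} {θ θ' : ℝ} (h : OrthoBound T k k' θ) (hθ : θ ≤ θ') :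
    OrthoBound T k k' θ' :=
  fun x y hx hy hd => (h x y hx hy hd).trans (by gcongr)

theorem OrthoBound.symm {k k' : ℕ} {θ : ℝ} (h : OrthoBound T k k' θ) : OrthoBound T k' k θ :=
  fun x y hx hy hd => by
    rw [real_inner_comm, mul_right_comm]
    exact h y x hy hx fun i => (hd i).symm

theorem OrthoBound.sq_inner_le_of_mem_cappedCube {k k' : ℕ} {θ : ℝ} (h : OrthoBound T k k' θ)
    {w g : Fin n → ℝ} (hw : w ∈ cappedCube (Fin n) k) {y : Vec n} (hy : nnzCount y ≤ k')
    (hd : ∀ i, g i = 0 ∨ y i = 0) :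
    inner ℝ (T (WithLp.toLp 2 (w * g))) (T y) ^ 2 ≤ (θ * ‖y‖) ^ 2 * ∑ i, w i * g i ^ 2 := by
  let L : (Fin n → ℝ) →ₗ[ℝ] ℝ :=
    innerₛₗ ℝ (T y) ∘ₗ T ∘ₗ (WithLp.linearEquiv 2 ℝ (Fin n → ℝ)).symm ∘ₗ LinearMap.mulRight ℝ g
  let M : (Fin n → ℝ) →ₗ[ℝ] ℝ := (θ * ‖y‖) ^ 2 • Fintype.linearCombination ℝ fun i => g i ^ 2
  have hL : ∀ v, L v = inner ℝ (T (WithLp.toLp 2 (v * g))) (T y) := fun v => real_inner_comm _ _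
  have hM : ∀ v, M v = (θ * ‖y‖) ^ 2 * ∑ i, v i * g i ^ 2 := fun v => rfl
  rw [← hL, ← hM]
  refine sq_le_of_mem_cappedCube (fun S hS => ?_) hw
  set x : Vec n := WithLp.toLp 2 (Set.indicator (S : Set (Fin n)) 1 * g) with hx
  have hxS : ∀ i, x i = if i ∈ S then g i else 0 := fun i => by simp [hx, Set.indicator_apply]
  have hsparse : nnzCount x ≤ k := (Finset.card_le_card fun i hi => by
    by_contra hiS
    simp [hxS, hiS] at hi).trans hS
  have hnorm : ‖x‖ ^ 2 = ∑ i, Set.indicator (S : Set (Fin n)) 1 i * g i ^ 2 := by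
    rw [EuclideanSpace.real_norm_sq_eq]
    exact Finset.sum_congr rfl fun i _ => by by_cases hi : i ∈ S <;> simp [hxS, hi]
  have hxy := h x y hsparse hy fun i => (hd i).imp_left fun hg => by simp [hxS, hg]
  rw [hL, hM, ← hx, ← hnorm, ← mul_pow, mul_right_comm, ← sq_abs]
  exact pow_le_pow_left₀ (abs_nonneg _) hxy 2

theorem OrthoBound.enlarge {p k q : ℕ} {θ : ℝ} (h : OrthoBound T p q θ) (hθ : 0 ≤ θ) (hp : 0 < p)
    (hpk : p ≤ k) : OrthoBound T k q (√(k / p) * θ) := by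
  intro x y hx hy hd
  have hp0 : (0 : ℝ) < p := mod_cast hp
  have hk0 : (0 : ℝ) < k := mod_cast hp.trans_le hpk
  have hpk0 : (0 : ℝ) < p / k := div_pos hp0 hk0
  -- Averaging over the `p`-element subsets of a `k`-element support gives each index weight `p/k`.
  let w : Fin n → ℝ := fun i => if x i = 0 then 0 else p / k
  have hw : w ∈ cappedCube (Fin n) p := by
    refine ⟨⟨fun i => ?_, fun i => ?_⟩, ?_⟩
    · simp only [w]; split_ifs <;> simp [hpk0.le]
    · simp only [w]; split_ifs
      · exact zero_le_one
      · exact (div_le_one hk0).2 (mod_cast hpk)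
    · calc ∑ i, w i = nnzCount x * (p / k) := by simp [w, Finset.sum_ite, nnzCount]
        _ ≤ k * (p / k) := by gcongr
        _ = p := mul_div_cancel₀ _ hk0.ne'
  have hwx : ∀ i, w i * x i = p / k * x i := fun i => by by_cases h0 : x i = 0 <;> simp [w, h0]
  have hvec : WithLp.toLp 2 (w * ⇑x) = (p / k : ℝ) • x := by ext i; exact hwx i
  have hsum : ∑ i, w i * x i ^ 2 = p / k * ‖x‖ ^ 2 := by
    rw [EuclideanSpace.real_norm_sq_eq, Finset.mul_sum]
    exact Finset.sum_congr rfl fun i _ => by rw [sq, ← mul_assoc, hwx, mul_assoc]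
  have hsq := h.sq_inner_le_of_mem_cappedCube hw hy hd
  rw [hvec, map_smul, real_inner_smul_left, hsum] at hsq
  refine abs_le_of_sq_le_sq ?_ (by positivity)
  refine le_of_mul_le_mul_left (a := (p / k : ℝ) ^ 2) ?_ (by positivity)
  rw [← mul_pow]
  refine hsq.trans_eq ?_
  rw [mul_pow, mul_pow, mul_pow, mul_pow, Real.sq_sqrt (by positivity)]
  field_simp

theorem IsometryBound.orthoBound_self {k : ℕ} {δ : ℝ} (h : IsometryBound T k δ) (hδ : 0 ≤ δ)
    (hk : 2 ≤ k) : OrthoBound T k k (√(9 / 2) * δ) := by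
  obtain ⟨p, q, hp, hpq, hqp, rfl⟩ : ∃ p q, 0 < p ∧ p ≤ q ∧ q ≤ p + 1 ∧ k = p + q :=
    ⟨k / 2, k - k / 2, by omega, by omega, by omega, by omega⟩
  have hsplit : OrthoBound T (p + q) (p + q) _ :=
    ((h.orthoBound le_rfl).enlarge hδ hp le_self_add).symm.enlarge (by positivity)
      (hp.trans_le hpq) le_add_self
  refine hsplit.mono ?_
  rw [← mul_assoc, ← Real.sqrt_mul (by positivity), div_mul_div_comm]
  refine mul_le_mul_of_nonneg_right (Real.sqrt_le_sqrt ?_) hδ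
  have hp0 : (0 : ℝ) < p := mod_cast hp
  have hq0 : (0 : ℝ) < q := mod_cast hp.trans_le hpq
  rw [div_le_div_iff₀ (by positivity) two_pos]
  -- The worst case is `k = 3`, split as `1 + 2`.
  have hcases : (p + q) * (p + q) * 2 ≤ 9 * (q * p) := by
    obtain rfl | rfl : q = p ∨ q = p + 1 := by omega
    · nlinarith
    · nlinarith
  exact_mod_cast hcases

end RestrictedIsometry

section Flat

variable {E : Type*} [NormedAddCommGroup E] [InnerProductSpace ℝ E] {n k : ℕ} {β : ℝ} {b : Vec n}

/-- The tail left behind by the `k` largest entries is spread out over many coordinates: its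
entries are at most `β / √k` and its `ℓ₁` norm is at most `√k β`. Such a vector behaves like a
`k`-sparse vector of norm `β`. -/
def IsFlat (k : ℕ) (β : ℝ) (b : Vec n) : Prop :=
  (∀ i, √k * |b i| ≤ β) ∧ l1Norm b ≤ √k * β

theorem l1Norm_nonneg (x : Vec n) : 0 ≤ l1Norm x :=
  Finset.sum_nonneg fun _ _ => abs_nonneg _

theorem IsFlat.nonneg (h : IsFlat k β b) (hk : 0 < k) : 0 ≤ β :=
  nonneg_of_mul_nonneg_right ((l1Norm_nonneg b).trans h.2) (by positivity)

theorem IsFlat.norm_le (h : IsFlat k β b) (hk : 0 < k) : ‖b‖ ≤ β := by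
  have hk0 : 0 < √(k : ℝ) := by positivity
  refine (sq_le_sq₀ (norm_nonneg b) (h.nonneg hk)).1 (le_of_mul_le_mul_left ?_ hk0)
  calc √k * ‖b‖ ^ 2 = ∑ i, √k * |b i| * |b i| := by
        simp only [EuclideanSpace.real_norm_sq_eq, Finset.mul_sum, mul_assoc, abs_mul_abs_self,
          pow_two (b _)]
    _ ≤ ∑ i, β * |b i| := by gcongr with i; exact h.1 i
    _ = β * l1Norm b := (Finset.mul_sum _ _ _).symm
    _ ≤ β * (√k * β) := mul_le_mul_of_nonneg_left h.2 (h.nonneg hk)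
    _ = √k * β ^ 2 := by ring

theorem OrthoBound.abs_inner_le_of_isFlat {T : Vec n →ₗ[ℝ] E} {k' : ℕ} {θ : ℝ}
    (h : OrthoBound T k k' θ) (hθ : 0 ≤ θ) (hb : IsFlat k β b) (hk : 0 < k) {y : Vec n}
    (hy : nnzCount y ≤ k') (hd : ∀ i, b i = 0 ∨ y i = 0) :
    |inner ℝ (T b) (T y)| ≤ θ * ‖y‖ * β := by
  have : 0 < √(k : ℝ) := by positivity
  obtain rfl | hβ := (hb.nonneg hk).eq_or_lt
  · simp [norm_le_zero_iff.1 (hb.norm_le hk)]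
  -- Write `b = w * g` with weights `w` in the capped cube and `|g i| ≤ β / √k`.
  let w : Fin n → ℝ := fun i => √k / β * |b i|
  let g : Fin n → ℝ := fun i => β / √k * SignType.sign (b i)
  have hw : w ∈ cappedCube (Fin n) k := by
    refine ⟨⟨fun i => by positivity, fun i => ?_⟩, ?_⟩
    · simpa [w, div_mul_eq_mul_div] using (div_le_one hβ).2 (hb.1 i)
    · calc ∑ i, w i = √k / β * l1Norm b := (Finset.mul_sum _ _ _).symm
        _ ≤ √k / β * (√k * β) := by gcongr; exact hb.2
        _ = k := by field_simp; exact Real.sq_sqrt k.cast_nonneg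
  have hwg : ∀ i, w i * g i = b i := fun i => by
    rw [mul_mul_mul_comm, abs_mul_sign]; field_simp
  have hsum : ∑ i, w i * g i ^ 2 ≤ β ^ 2 :=
    calc ∑ i, w i * g i ^ 2 = β / √k * l1Norm b := by
          rw [l1Norm, Finset.mul_sum]
          refine Finset.sum_congr rfl fun i _ => ?_
          rw [sq, ← mul_assoc, hwg, mul_left_comm, self_mul_sign]
      _ ≤ β / √k * (√k * β) := by gcongr; exact hb.2
      _ = β ^ 2 := by field_simp
  have hsq := h.sq_inner_le_of_mem_cappedCube hw (g := g) hy
    fun i => (hd i).imp_left fun h0 => by simp [g, h0]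
  rw [show WithLp.toLp 2 (w * g) = b by ext i; exact hwg i] at hsq
  refine abs_le_of_sq_le_sq (hsq.trans ?_) (by positivity)
  rw [mul_pow _ β]
  gcongr

end Flat

section TopRestriction

variable {n k : ℕ} {x y : Vec n}

theorem exists_isTopRestriction (x : Vec n) (k : ℕ) : ∃ y, IsTopRestriction x k y := by
  let σ := Tuple.sort fun i => -|x i|
  have hmono : Monotone ((fun i => -|x i|) ∘ σ) := Tuple.monotone_sort _
  let S : Finset (Fin n) := (Finset.univ.filter fun i : Fin n => (i : ℕ) < k).map σ.toEmbedding
  have hS : ∀ i, i ∈ S ↔ (σ.symm i : ℕ) < k := fun i => by simp [S]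
  refine ⟨WithLp.toLp 2 fun i => if i ∈ S then x i else 0, S, ?_, fun i hi j hj => ?_,
    fun i => rfl⟩
  · rw [Finset.card_map, Fin.card_filter_val_lt, min_comm]
  · have hij : σ.symm i ≤ σ.symm j :=
      Fin.le_def.2 (((hS i).1 hi).le.trans (not_lt.1 (mt (hS j).2 hj)))
    simpa using hmono hij

theorem IsTopRestriction.nnzCount_le (h : IsTopRestriction x k y) : nnzCount y ≤ k := by
  obtain ⟨S, hS, -, hy⟩ := h
  refine (Finset.card_le_card fun i hi => ?_).trans (hS.le.trans (min_le_left k n))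
  by_contra hiS
  simp [hy, hiS] at hi

theorem IsTopRestriction.sub_apply_eq_zero_or (h : IsTopRestriction x k y) (i : Fin n) :
    (x - y) i = 0 ∨ y i = 0 := by
  obtain ⟨S, -, -, hy⟩ := h
  by_cases hi : i ∈ S <;> simp [hy, hi]

theorem IsTopRestriction.l1Norm_add_l1Norm_sub (h : IsTopRestriction x k y) :
    l1Norm y + l1Norm (x - y) = l1Norm x := by
  rw [l1Norm, l1Norm, ← Finset.sum_add_distrib]
  refine Finset.sum_congr rfl fun i _ => ?_
  obtain hi | hi := h.sub_apply_eq_zero_or i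
  · have hxy : x i = y i := sub_eq_zero.1 hi
    simp [hxy]
  · simp [hi]

theorem sum_le_sum_of_forall_notMem_le {ι : Type*} {f : ι → ℝ} (hf : ∀ i, 0 ≤ f i)
    {S T : Finset ι} (hST : S.card ≤ T.card) (hT : ∀ i ∈ T, ∀ j ∉ T, f j ≤ f i) :
    ∑ i ∈ S, f i ≤ ∑ i ∈ T, f i := by
  classical
  rw [← Finset.sum_sdiff_le_sum_sdiff]
  obtain hempty | hne := (S \ T).eq_empty_or_nonempty
  · simpa [hempty] using Finset.sum_nonneg fun i _ => hf i
  obtain ⟨j, hj, hmax⟩ := Finset.exists_max_image _ f hne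
  calc ∑ i ∈ S \ T, f i ≤ (S \ T).card • f j := Finset.sum_le_card_nsmul _ _ _ hmax
    _ ≤ (T \ S).card • f j :=
        nsmul_le_nsmul_left (hf j) (Finset.card_sdiff_le_card_sdiff_iff.2 hST)
    _ ≤ ∑ i ∈ T \ S, f i := Finset.card_nsmul_le_sum _ _ _ fun i hi =>
        hT i (Finset.mem_sdiff.1 hi).1 j (Finset.mem_sdiff.1 hj).2

theorem IsTopRestriction.sum_abs_le_l1Norm (h : IsTopRestriction x k y) {S : Finset (Fin n)}
    (hS : S.card ≤ min k n) : ∑ i ∈ S, |x i| ≤ l1Norm y := by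
  obtain ⟨T, hT, htop, hy⟩ := h
  have hl1 : l1Norm y = ∑ i ∈ T, |x i| := by simp [l1Norm, hy, apply_ite abs, Finset.sum_ite_mem]
  rw [hl1]
  exact sum_le_sum_of_forall_notMem_le (fun i => abs_nonneg _) (hS.trans_eq hT.symm) htop

theorem IsTopRestriction.mul_abs_sub_apply_le (h : IsTopRestriction x k y) (i : Fin n) :
    k * |(x - y) i| ≤ l1Norm y := by
  obtain ⟨T, hT, htop, hy⟩ := id h
  by_cases hi : i ∈ T
  · simpa [hy, hi] using l1Norm_nonneg y
  have hTk : T.card = k := by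
    have hlt : T.card < n := by simpa using Finset.card_lt_univ_of_notMem hi
    omega
  calc k * |(x - y) i| = T.card • |x i| := by simp [hy, hi, hTk]
    _ ≤ ∑ j ∈ T, |x j| := Finset.card_nsmul_le_sum _ _ _ fun j hj => htop j hj i hi
    _ ≤ l1Norm y := h.sum_abs_le_l1Norm hT.le

theorem l1Norm_le_sqrt_mul_norm (hx : nnzCount x ≤ k) : l1Norm x ≤ √k * ‖x‖ := by
  refine le_of_sq_le_sq ?_ (by positivity)
  calc l1Norm x ^ 2 = (∑ i with x i ≠ 0, |x i|) ^ 2 := by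
        rw [Finset.sum_filter_of_ne fun i _ hi => abs_ne_zero.1 hi, l1Norm]
    _ ≤ nnzCount x * ∑ i with x i ≠ 0, |x i| ^ 2 := sq_sum_le_card_mul_sum_sq
    _ ≤ k * ∑ i, |x i| ^ 2 := by
        gcongr
        exact Finset.filter_subset _ _
    _ = (√k * ‖x‖) ^ 2 := by
        rw [mul_pow, Real.sq_sqrt k.cast_nonneg, EuclideanSpace.real_norm_sq_eq]
        simp only [sq_abs]

theorem l1Norm_sub_le_two_mul {x₀ x' : Vec n} (hle : l1Norm x' ≤ l1Norm x₀)
    (S : Finset (Fin n)) :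
    l1Norm (x₀ - x') ≤ 2 * ∑ i ∈ S, |(x₀ - x') i| + 2 * ∑ i ∈ Sᶜ, |x₀ i| := by
  have hpointwise : ∀ i, |(x₀ - x') i| ≤
      |x' i| - |x₀ i| + ((if i ∈ S then 2 * |(x₀ - x') i| else 0) +
        if i ∈ Sᶜ then 2 * |x₀ i| else 0) := fun i => by
    by_cases hi : i ∈ S
    · simpa [hi] using by linarith [abs_sub_abs_le_abs_sub (x₀ i) (x' i)]
    · simpa [hi] using by linarith [abs_sub (x₀ i) (x' i)]
  have hsum := Finset.sum_le_sum fun i (_ : i ∈ Finset.univ) => hpointwise i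
  simp only [Finset.sum_add_distrib, Finset.sum_sub_distrib, Finset.sum_ite_mem,
    Finset.univ_inter, ← Finset.mul_sum] at hsum
  simp only [l1Norm] at hle ⊢
  linarith

theorem IsTopRestriction.l1Norm_sub_le_of_l1Norm_le {x₀ x' xk a : Vec n}
    (hle : l1Norm x' ≤ l1Norm x₀) (hxk : IsTopRestriction x₀ k xk)
    (ha : IsTopRestriction (x₀ - x') k a) :
    l1Norm (x₀ - x' - a) ≤ l1Norm a + 2 * l1Norm (x₀ - xk) := by
  obtain ⟨S, hS, -, hSxk⟩ := hxk
  have htail : l1Norm (x₀ - xk) = ∑ i ∈ Sᶜ, |x₀ i| := by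
    rw [l1Norm, ← Finset.sum_subset Sᶜ.subset_univ fun i _ hi => by
      simp [hSxk, Finset.notMem_compl.1 hi]]
    exact Finset.sum_congr rfl fun i hi => by simp [hSxk, Finset.mem_compl.1 hi]
  linarith [l1Norm_sub_le_two_mul hle S, ha.sum_abs_le_l1Norm hS.le, ha.l1Norm_add_l1Norm_sub]

theorem IsTopRestriction.isFlat_sub (h : IsTopRestriction x k y) (hk : 0 < k) {τ : ℝ} (hτ : 0 ≤ τ)
    (hcone : l1Norm (x - y) ≤ l1Norm y + √k * τ) : IsFlat k (‖y‖ + τ) (x - y) := by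
  have hl1 := l1Norm_le_sqrt_mul_norm h.nnzCount_le
  refine ⟨fun i => ?_, by linarith⟩
  have hentry : √k * |(x - y) i| ≤ ‖y‖ := by
    refine le_of_mul_le_mul_left ?_ (by positivity : 0 < √(k : ℝ))
    rw [← mul_assoc, Real.mul_self_sqrt k.cast_nonneg]
    exact (h.mul_abs_sub_apply_le i).trans hl1
  linarith

end TopRestriction

section Recovery

theorem norm_le_of_isFlat {E : Type*} [NormedAddCommGroup E] [InnerProductSpace ℝ E] {n k : ℕ}
    {T : Vec n →ₗ[ℝ] E} {δ θ τ : ℝ} (hI : IsometryBound T k δ) (hO : OrthoBound T k k θ)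
    (hδ : 0 ≤ δ) (hθ : 0 ≤ θ) (hk : 0 < k) {a b : Vec n} (ha : nnzCount a ≤ k)
    (hd : ∀ i, b i = 0 ∨ a i = 0) (hb : IsFlat k (‖a‖ + τ) b) :
    (1 - δ - θ) * ‖a‖ ≤ √(1 + δ) * ‖T (a + b)‖ + θ * τ := by
  obtain h0 | ha0 := (norm_nonneg a).eq_or_lt
  · have hτ : 0 ≤ τ := by simpa [← h0] using hb.nonneg hk
    rw [← h0, mul_zero]
    positivity
  have hTa : ‖T a‖ ≤ √(1 + δ) * ‖a‖ := by
    refine le_of_sq_le_sq ?_ (by positivity)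
    rw [mul_pow, Real.sq_sqrt (by positivity)]
    exact (hI a ha).2
  have hcross := (abs_le.1 (hO.abs_inner_le_of_isFlat hθ hb hk ha hd)).1
  refine le_of_mul_le_mul_right ?_ ha0
  suffices (1 - δ) * ‖a‖ ^ 2 ≤ ‖T (a + b)‖ * (√(1 + δ) * ‖a‖) + θ * ‖a‖ * (‖a‖ + τ) by linarith
  calc (1 - δ) * ‖a‖ ^ 2 ≤ ‖T a‖ ^ 2 := (hI a ha).1
    _ = inner ℝ (T (a + b)) (T a) - inner ℝ (T b) (T a) := by
        rw [map_add, inner_add_left, add_sub_cancel_right, real_inner_self_eq_norm_sq]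
    _ ≤ ‖T (a + b)‖ * ‖T a‖ + θ * ‖a‖ * (‖a‖ + τ) := by
        linarith [real_inner_le_norm (T (a + b)) (T a)]
    _ ≤ ‖T (a + b)‖ * (√(1 + δ) * ‖a‖) + θ * ‖a‖ * (‖a‖ + τ) := by gcongr

variable {m n k : ℕ} {A : Matrix (Fin m) (Fin n) ℝ} {δ θ ρ ε : ℝ}

theorem VecAsGood.norm_apply_sub_le {x₀ x' : Vec n} {z : Vec m}
    (h : VecAsGood A ε (A.toEuclideanLin x₀ + z) x₀ x') (hz : ‖z‖ ≤ ε) :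
    ‖A.toEuclideanLin (x₀ - x')‖ ≤ 2 * ε := by
  have hsplit : A.toEuclideanLin (x₀ - x') =
      -(A.toEuclideanLin x' - (A.toEuclideanLin x₀ + z)) - z := by rw [map_sub]; abel
  rw [hsplit]
  refine (norm_sub_le _ _).trans ?_
  rw [norm_neg]
  linarith [h.1]

theorem VecAsGood.exists_isFlat_sub (hI : IsometryBound A.toEuclideanLin k δ)
    (hO : OrthoBound A.toEuclideanLin k k θ) (hδ : 0 ≤ δ) (hθ : 0 ≤ θ) (hρ : δ + θ ≤ ρ)
    (hρ1 : ρ < 1) (hk : 0 < k) {x₀ x' xk : Vec n} {z : Vec m} (hz : ‖z‖ ≤ ε)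
    (h : VecAsGood A ε (A.toEuclideanLin x₀ + z) x₀ x') (hxk : IsTopRestriction x₀ k xk) :
    ∃ a τ, √k * τ = 2 * l1Norm (x₀ - xk) ∧ (1 - ρ) * ‖a‖ ≤ 4 * ε + ρ * τ ∧ nnzCount a ≤ k ∧
      IsFlat k (‖a‖ + τ) (x₀ - x' - a) := by
  obtain ⟨a, ha⟩ := exists_isTopRestriction (x₀ - x') k
  set τ := 2 * l1Norm (x₀ - xk) / √k
  have hτ0 : 0 ≤ τ := div_nonneg (mul_nonneg zero_le_two (l1Norm_nonneg _)) (Real.sqrt_nonneg _)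
  have hσ : √k * τ = 2 * l1Norm (x₀ - xk) := mul_div_cancel₀ _ (by positivity)
  have hflat : IsFlat k (‖a‖ + τ) (x₀ - x' - a) :=
    ha.isFlat_sub hk hτ0 (hσ ▸ hxk.l1Norm_sub_le_of_l1Norm_le h.2 ha)
  refine ⟨a, τ, hσ, ?_, ha.nnzCount_le, hflat⟩
  have hhead := norm_le_of_isFlat hI hO hδ hθ hk ha.nnzCount_le ha.sub_apply_eq_zero_or hflat
  rw [add_sub_cancel] at hhead
  have hsqrt : √(1 + δ) ≤ 2 := Real.sqrt_le_iff.2 ⟨by norm_num, by linarith⟩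
  calc (1 - ρ) * ‖a‖ ≤ (1 - δ - θ) * ‖a‖ :=
        mul_le_mul_of_nonneg_right (by linarith) (norm_nonneg a)
    _ ≤ √(1 + δ) * ‖A.toEuclideanLin (x₀ - x')‖ + θ * τ := hhead
    _ ≤ 2 * (2 * ε) + ρ * τ := by gcongr; exacts [h.norm_apply_sub_le hz, by linarith]
    _ = 4 * ε + ρ * τ := by ring

theorem vecL2Robust_of_isometryBound_orthoBound (hI : IsometryBound A.toEuclideanLin k δ)
    (hO : OrthoBound A.toEuclideanLin k k θ) (hδ : 0 ≤ δ) (hθ : 0 ≤ θ) (hρ : δ + θ ≤ ρ)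
    (hρ1 : ρ < 1) (hk : 0 < k) (ε : ℝ) :
    VecL2Robust A k ε (2 * (1 + ρ) / (1 - ρ)) (8 / (1 - ρ)) := by
  intro x₀ x' xk z hz h hxk
  obtain ⟨a, τ, hσ, ha, -, hflat⟩ := h.exists_isFlat_sub hI hO hδ hθ hρ hρ1 hk hz hxk
  have hρ' : 0 < 1 - ρ := sub_pos.2 hρ1
  have hτ : τ = 2 * l1Norm (x₀ - xk) / √k := eq_div_of_mul_eq (by positivity) (by linarith)
  calc ‖x₀ - x'‖ = ‖a + (x₀ - x' - a)‖ := by rw [add_sub_cancel]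
    _ ≤ ‖a‖ + ‖x₀ - x' - a‖ := norm_add_le _ _
    _ ≤ 2 * ‖a‖ + τ := by linarith [hflat.norm_le hk]
    _ ≤ 2 * ((4 * ε + ρ * τ) / (1 - ρ)) + τ := by gcongr; rwa [le_div_iff₀' hρ']
    _ = 2 * (1 + ρ) / (1 - ρ) / √k * l1Norm (x₀ - xk) + 8 / (1 - ρ) * ε := by
        rw [hτ]; field_simp; ring

theorem vecL1Robust_of_isometryBound_orthoBound (hI : IsometryBound A.toEuclideanLin k δ)
    (hO : OrthoBound A.toEuclideanLin k k θ) (hδ : 0 ≤ δ) (hθ : 0 ≤ θ) (hρ : δ + θ ≤ ρ)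
    (hρ1 : ρ < 1) (hk : 0 < k) : VecL1Robust A k 0 (2 * (1 + ρ) / (1 - ρ)) := by
  intro x₀ x' xk z hz h hxk
  obtain ⟨a, τ, hσ, ha, hak, hflat⟩ := h.exists_isFlat_sub hI hO hδ hθ hρ hρ1 hk hz hxk
  have hρ' : 0 < 1 - ρ := sub_pos.2 hρ1
  calc l1Norm (x₀ - x') = l1Norm (a + (x₀ - x' - a)) := by rw [add_sub_cancel]
    _ ≤ l1Norm a + l1Norm (x₀ - x' - a) :=
        (Finset.sum_le_sum fun i _ => abs_add_le _ _).trans_eq Finset.sum_add_distrib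
    _ ≤ √k * ‖a‖ + √k * (‖a‖ + τ) := add_le_add (l1Norm_le_sqrt_mul_norm hak) hflat.2
    _ ≤ √k * (ρ * τ / (1 - ρ)) + √k * (ρ * τ / (1 - ρ) + τ) := by
        have hnorm : ‖a‖ ≤ ρ * τ / (1 - ρ) := by rw [le_div_iff₀' hρ']; linarith
        gcongr
    _ = (1 + ρ) / (1 - ρ) * (√k * τ) := by field_simp; ring
    _ = 2 * (1 + ρ) / (1 - ρ) * l1Norm (x₀ - xk) := by rw [hσ]; ring

theorem exists_isometryBound_orthoBound
    (h : (2 ≤ k ∧ vecRIC A k < 0.307) ∨ vecRIC A (2 * k) < 0.472) :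
    ∃ δ θ, IsometryBound A.toEuclideanLin k δ ∧ OrthoBound A.toEuclideanLin k k θ ∧ 0 ≤ δ ∧
      0 ≤ θ ∧ δ + θ ≤ 0.96 := by
  obtain ⟨hk, h⟩ | h := h
  · have hI := isometryBound_of_vecRIC_lt h
    have hsqrt : √(9 / 2 : ℝ) ≤ 2.122 := Real.sqrt_le_iff.2 ⟨by norm_num, by norm_num⟩
    exact ⟨_, _, hI, hI.orthoBound_self (by norm_num) hk, by norm_num, by positivity,
      by linarith⟩
  · have hI := isometryBound_of_vecRIC_lt h
    exact ⟨0.472, 0.472, hI.of_le (by omega), hI.orthoBound (by omega), by norm_num, by norm_num,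
      by norm_num⟩

theorem vec_robust_of_vecRIC_lt (hk : 0 < k)
    (h : (2 ≤ k ∧ vecRIC A k < 0.307) ∨ vecRIC A (2 * k) < 0.472) :
    (∀ ε, VecL2Robust A k ε 98 200) ∧ VecL1Robust A k 0 98 := by
  obtain ⟨δ, θ, hI, hO, hδ, hθ, hρ⟩ := exists_isometryBound_orthoBound h
  have hL2 := vecL2Robust_of_isometryBound_orthoBound hI hO hδ hθ hρ (by norm_num) hk
  have hL1 := vecL1Robust_of_isometryBound_orthoBound hI hO hδ hθ hρ (by norm_num) hk
  norm_num at hL2 hL1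
  exact ⟨hL2, hL1⟩

end Recovery

end LowRank

theorem mainTheorem3 :
    (∀ (m n₁ n₂ k : ℕ), n₁ ≤ n₂ → 1 ≤ k → ∀ (F : Set RIPInequality) (ε C₁ C₂ C₃ : ℝ),
      ((∀ A : Matrix (Fin m) (Fin n₁) ℝ, VecSatisfies F A → VecL2Robust A k ε C₁ C₂) →
        ∀ 𝒜 : MeasOp m n₁ n₂, OpSatisfies F 𝒜 → MatFrobRobust 𝒜 k ε C₁ C₂) ∧
      ((∀ A : Matrix (Fin m) (Fin n₁) ℝ, VecSatisfies F A → VecL1Robust A k ε C₃) →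
        ∀ 𝒜 : MeasOp m n₁ n₂, OpSatisfies F 𝒜 → MatNuclearRobust 𝒜 k ε C₃)) ∧
    (∃ C₁ C₂ C₃ : ℝ, 0 < C₁ ∧ 0 < C₂ ∧ 0 < C₃ ∧
      ∀ (m n₁ n₂ k : ℕ), n₁ ≤ n₂ → 1 ≤ k → ∀ 𝒜 : MeasOp m n₁ n₂,
        ((2 ≤ k ∧ opRIC 𝒜 k < 0.307) ∨ opRIC 𝒜 (2 * k) < 0.472) →
          (∀ ε : ℝ, MatFrobRobust 𝒜 k ε C₁ C₂) ∧ MatNuclearRobust 𝒜 k 0 C₃) := by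
  refine ⟨fun m n₁ n₂ k hn _ F ε C₁ C₂ C₃ => ⟨fun h 𝒜 hF => ?_, fun h 𝒜 hF => ?_⟩,
    98, 200, 98, by norm_num, by norm_num, by norm_num, fun m n₁ n₂ k hn hk 𝒜 hRIC => ?_⟩
  · exact matFrobRobust_of_compression hn fun U V hUV => h _ (hF.vecSatisfies_compression hUV)
  · exact matNuclearRobust_of_compression hn fun U V hUV => h _ (hF.vecSatisfies_compression hUV)
  · have hvec : ∀ U V, IsUnitaryPair U V → (∀ ε, VecL2Robust (compression 𝒜 U V) k ε 98 200) ∧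
        VecL1Robust (compression 𝒜 U V) k 0 98 := fun U V hUV =>
      vec_robust_of_vecRIC_lt hk <| hRIC.imp
        (And.imp_right (vecRIC_compression_le 𝒜 hUV k).trans_lt)
        (vecRIC_compression_le 𝒜 hUV (2 * k)).trans_lt
    exact ⟨fun ε => matFrobRobust_of_compression hn fun U V hUV => (hvec U V hUV).1 ε,
      matNuclearRobust_of_compression hn fun U V hUV => (hvec U V hUV).2⟩
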